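/- Let $n,m\ge 1$, let $1<s\le\infty$ with conjugate exponent $s'$ ($\frac1s+\frac1{s'}=1$), let $1\le s'<p_i<\infty$ for $i=1,\dots,m$, put $\vec P=(p_1,\dots,p_m)$ and $\frac1p=\sum_{i=1}^m\frac1{p_i}$. Then there is a constant $C=C(n,m,\vec P,s)<\infty$ with the following property. All cubes $Q\subset\mathbb R^n$ have sides parallel to the axes, and $\langle g\rangle_Q=\frac1{|Q|}\int_Q g$. Let $\vec\omega=(\omega_1,\dots,\omega_m)$ be nonnegative measurable functions on $\mathbb R^n$, let $\nu_{\vec\omega}=\prod_{i=1}^m\omega_i^{p/p_i}$ and $\sigma_i=\omega_i^{1-(p_i/s')'}$, where $r'=\frac r{r-1}$, and assume $\vec\omega\in A_{\vec P/s'}$, that is, $$[\vec\omega]_{A_{\vec P/s'}}=\sup_Q\ \langle\nu_{\vec\omega}\rangle_Q\prod_{i=1}^m\langle\sigma_i\rangle_Q^{\frac{p/s'}{(p_i/s')'}}<\infty .$$ For a weight $\sigma$ let $[\sigma]_{A_\infty}=\sup_Q\frac1{\sigma(Q)}\int_Q M(\sigma 1_Q)$, where $\sigma(Q)=\int_Q\sigma$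 and $M$ is the Hardy–Littlewood maximal operator over cubes. Let $\vec f=(f_1,\dots,f_m)$ be measurable functions on $\mathbb R^n$, and for $\Omega:(\mathbb R^n)^m\to\mathbb C$ let $$\mathcal M_\Omega(\vec f)(x)=\sup_{Q\ni x}\frac1{|Q|^m}\int_{Q^m}|\Omega(x-y_1,\dots,x-y_m)|\prod_{i=1}^m|f_i(y_i)|\,d\vec y .$$ (a) If $\Omega(\lambda y_1,\dots,\lambda y_m)=\Omega(y_1,\dots,y_m)$ for all $\lambda>0$ and all $y_1,\dots,y_m\in\mathbb R^n$, and $\Omega\in L^s(S^{mn-1})$, where $S^{mn-1}$ is the unit sphere of $(\mathbb R^n)^m=\mathbb R^{mn}$ with its surface measure, then $$\|\mathcal M_\Omega(\vec f)\|_{L^p(\nu_{\vec\omega})}\le C\,\|\Omega\|_{L^s(S^{mn-1})}\,[\vec\omega]_{A_{\vec P/s'}}^{1/p}\ \prod_{i=1}^m[\sigma_i]_{A_\infty}^{1/p_i}\ \prod_{i=1}^m\|f_i\|_{L^{p_i}(\omega_i)} .$$ (b) If $\Omega$ is homogeneous of degree zero in each variable, that is, $\Omega(\lambda_1y_1,\dots,\lambda_my_m)=\Omega(y_1,\dots,y_m)$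 for all $\lambda_1,\dots,\lambda_m>0$ and all $y_1,\dots,y_m\in\mathbb R^n$, and $\Omega\in L^s((S^{n-1})^m)$ with respect to the product of the surface measures, then the same inequality holds with $\|\Omega\|_{L^s((S^{n-1})^m)}$ in place of $\|\Omega\|_{L^s(S^{mn-1})}$. (Both inequalities are between elements of $[0,\infty]$, with $0\cdot\infty=0$.) -/

import Mathlib

open MeasureTheory
open scoped ENNReal NNReal

noncomputable section

/-- A (closed) cube in `ℝⁿ` with sides parallel to the axes and positive side length. -/
def IsCube {n : ℕ} (Q : Set (EuclideanSpace ℝ (Fin n))) : Prop :=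
  ∃ (a : EuclideanSpace ℝ (Fin n)) (l : ℝ), 0 < l ∧
    Q = {x | ∀ j, a j ≤ x j ∧ x j ≤ a j + l}

/-- The average `|Q|⁻¹ ∫_Q g` of a nonnegative function `g` over `Q`. -/
def cubeAvg {n : ℕ} (Q : Set (EuclideanSpace ℝ (Fin n)))
    (g : EuclideanSpace ℝ (Fin n) → ℝ≥0∞) : ℝ≥0∞ :=
  (volume Q)⁻¹ * ∫⁻ y in Q, g y

/-- The Hardy–Littlewood maximal function of `g ≥ 0`: the supremum of the averages of `g` over
all cubes containing the point. -/
def hlMaximal {n : ℕ} (g : EuclideanSpace ℝ (Fin n) → ℝ≥0∞) (x : EuclideanSpace ℝ (Fin n)) :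
    ℝ≥0∞ :=
  ⨆ (Q : Set (EuclideanSpace ℝ (Fin n))) (_ : IsCube Q) (_ : x ∈ Q), cubeAvg Q g

/-- The `A_∞` constant (Fujii–Wilson) of a weight `σ`:
the supremum over all cubes `Q` of `σ(Q)⁻¹ ∫_Q M(σ 1_Q)`. -/
def aInftyConst {n : ℕ} (σ : EuclideanSpace ℝ (Fin n) → ℝ≥0∞) : ℝ≥0∞ :=
  ⨆ (Q : Set (EuclideanSpace ℝ (Fin n))) (_ : IsCube Q),
    (∫⁻ x in Q, hlMaximal (Q.indicator σ) x) / ∫⁻ x in Q, σ x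

/-- The weight `ν_ω = ∏ ω_i ^ (p / p_i)`. -/
def jointWeight {n m : ℕ} (p : ℝ) (P : Fin m → ℝ)
    (ω : Fin m → EuclideanSpace ℝ (Fin n) → ℝ≥0) (x : EuclideanSpace ℝ (Fin n)) : ℝ≥0∞ :=
  ∏ i, (ω i x : ℝ≥0∞) ^ (p / P i)

/-- The dual weight `w ^ (1 - r')`, `r' = r / (r - 1)`. It is computed in `[0, ∞]`, so for `r > 1`
it is `∞` where `w = 0`. -/
def dualWeight {n : ℕ} (r : ℝ) (w : EuclideanSpace ℝ (Fin n) → ℝ≥0)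
    (x : EuclideanSpace ℝ (Fin n)) : ℝ≥0∞ :=
  (w x : ℝ≥0∞) ^ (1 - Real.conjExponent r)

/-- The multilinear `A_P` constant, where `P = (p_1, …, p_m)` and `1/p = ∑ 1/p_i`:
the supremum over all cubes `Q` of
`∏ (⨍_Q ω_i ^ (1 - p_i')) ^ (p / p_i') * ⨍_Q ν_ω`. -/
def apConst {n m : ℕ} (p : ℝ) (P : Fin m → ℝ)
    (ω : Fin m → EuclideanSpace ℝ (Fin n) → ℝ≥0) : ℝ≥0∞ :=
  ⨆ (Q : Set (EuclideanSpace ℝ (Fin n))) (_ : IsCube Q),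
    (∏ i, cubeAvg Q (dualWeight (P i) (ω i)) ^ (p / Real.conjExponent (P i))) *
      cubeAvg Q (jointWeight p P ω)

/-- The multilinear maximal operator with rough kernel `Ω`:
`M_Ω(f)(x) = sup_{Q ∋ x} |Q|^{-m} ∫_{Q^m} |Ω(x - y_1, …, x - y_m)| ∏ |f_i(y_i)| dy`. -/
def roughMaximal {n m : ℕ} (Ω : (Fin m → EuclideanSpace ℝ (Fin n)) → ℂ)
    (f : Fin m → EuclideanSpace ℝ (Fin n) → ℂ) (x : EuclideanSpace ℝ (Fin n)) : ℝ≥0∞ :=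
  ⨆ (Q : Set (EuclideanSpace ℝ (Fin n))) (_ : IsCube Q) (_ : x ∈ Q),
    (volume Q ^ m)⁻¹ *
      ∫⁻ y in Set.univ.pi (fun _ : Fin m => Q), ‖Ω (fun i => x - y i)‖ₑ * ∏ i, ‖f i (y i)‖ₑ

/-- `‖g‖_{L^r(w)} = (∫ |g|^r w) ^ (1/r)` for `0 < r < ∞`, with respect to Lebesgue measure. -/
def weightedNorm {n : ℕ} {F : Type*} [ENorm F] (g : EuclideanSpace ℝ (Fin n) → F) (r : ℝ)
    (w : EuclideanSpace ℝ (Fin n) → ℝ≥0∞) : ℝ≥0∞ :=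
  eLpNorm g (ENNReal.ofReal r) (volume.withDensity w)

/-- The restriction of `Ω` to the unit sphere `S^{mn-1}` of `(ℝⁿ)^m = ℝ^{mn}`. -/
def restrictSphere {n m : ℕ} (Ω : (Fin m → EuclideanSpace ℝ (Fin n)) → ℂ)
    (θ : Metric.sphere (0 : PiLp 2 (fun _ : Fin m => EuclideanSpace ℝ (Fin n))) 1) : ℂ :=
  Ω (fun i => θ.1 i)

/-- The surface measure of `S^{mn-1}`. -/
def sphereMeasure (n m : ℕ) :
    Measure (Metric.sphere (0 : PiLp 2 (fun _ : Fin m => EuclideanSpace ℝ (Fin n))) 1) :=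
  (volume : Measure (PiLp 2 (fun _ : Fin m => EuclideanSpace ℝ (Fin n)))).toSphere

/-- The restriction of `Ω` to the product of unit spheres `(S^{n-1})^m`. -/
def restrictSpheres {n m : ℕ} (Ω : (Fin m → EuclideanSpace ℝ (Fin n)) → ℂ)
    (θ : Fin m → Metric.sphere (0 : EuclideanSpace ℝ (Fin n)) 1) : ℂ :=
  Ω (fun i => (θ i).1)

/-- The product of the surface measures of the factors on `(S^{n-1})^m`. -/
def spheresMeasure (n m : ℕ) :
    Measure (Fin m → Metric.sphere (0 : EuclideanSpace ℝ (Fin n)) 1) :=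
  Measure.pi (fun _ => (volume : Measure (EuclideanSpace ℝ (Fin n))).toSphere)

end

/-!
Hölder's inequality with exponents `s`, `s'` on `Q ^ m` separates `Ω` from the `f i`. By homogeneity
the `L^s` mean of `Ω` over a ball is, up to a constant, its `L^s` norm on the sphere (or on the
product of spheres), so `roughMaximal Ω f` is at most a multiple of this norm times the `1 / s'`
power of the multilinear maximal function of the `|f i| ^ s'`. It remains to bound the latter on
`L^q(ν)`, `q = p / s'`, with exponents `r i = P i / s'` and `g i = |f i| ^ s'`.

By the one-third trick it suffices to consider finitely many cubes from one dyadic grid. Select the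
principal cubes, at which the product of the averages of the `g i` jumps by a factor `2 ^ m`: at
least half of each principal cube lies outside the smaller ones, so by the Fujii–Wilson condition
the masses `σ i Q` of the principal cubes `Q` form a Carleson family. Extracting the `A_P` constant
from each cube reduces the bound to the sum over principal cubes `Q` of
`∏ i, (σ i Q * ⟨g i / σ i⟩ ^ r i) ^ (q / r i)`, the averages being over `Q` with respect to `σ i`.
As `∑ i, q / r i = 1`, this sum is controlled by Hölder's inequality and the Carleson embedding
theorem for each `i`.
-/

theorem exists_principal_subfamily {ι : Type*} [PartialOrder ι] (A : ι → ℝ≥0∞)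
    {a : ℝ≥0∞} (ha : 1 ≤ a) (F : Finset ι) :
    ∃ S ⊆ F, (∀ Q ∈ S, ∀ R ∈ S, Q < R → a * A R < A Q) ∧
      ∀ Q ∈ F, ∃ R ∈ S, Q ≤ R ∧ A Q ≤ a * A R := by
  classical
  induction F using Finset.strongInduction with
  | H F ih =>
    rcases F.eq_empty_or_nonempty with rfl | hne
    · exact ⟨∅, by simp⟩
    -- Larger members are selected first: remove a minimal `Q`, then add it only if needed.
    obtain ⟨Q, hQF, hQmin⟩ := F.exists_minimal hne
    obtain ⟨S, hSF, hgrowth, hcover⟩ := ih (F.erase Q) (Finset.erase_ssubset hQF)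
    have hcover' : ∀ R ∈ F, R = Q ∨ ∃ T ∈ S, R ≤ T ∧ A R ≤ a * A T := fun R hR =>
      or_iff_not_imp_left.2 fun hne => hcover R (Finset.mem_erase.2 ⟨hne, hR⟩)
    by_cases hQ : ∃ R ∈ S, Q ≤ R ∧ A Q ≤ a * A R
    · exact ⟨S, hSF.trans (F.erase_subset Q), hgrowth, fun R hR =>
        (hcover' R hR).elim (fun h => h ▸ hQ) id⟩
    push Not at hQ
    refine ⟨insert Q S, Finset.insert_subset hQF (hSF.trans (F.erase_subset Q)), ?_, ?_⟩
    · simp only [Finset.mem_insert]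
      rintro R (rfl | hR) T (rfl | hT) hRT
      · exact absurd hRT (lt_irrefl _)
      · exact hQ T hT hRT.le
      · exact absurd hRT (hQmin (Finset.mem_of_mem_erase (hSF hR)) hRT.le).not_gt
      · exact hgrowth R hR T hT hRT
    · intro R hR
      rcases hcover' R hR with rfl | ⟨T, hT, h⟩
      · exact ⟨R, Finset.mem_insert_self _ _, le_rfl, le_mul_of_one_le_left' ha⟩
      · exact ⟨T, Finset.mem_insert_of_mem hT, h⟩

theorem rpow_sum_of_nonneg {ι : Type*} {s : Finset ι} {p : ι → ℝ} (hp : ∀ i ∈ s, 0 ≤ p i)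
    (x : ℝ≥0∞) : x ^ ∑ i ∈ s, p i = ∏ i ∈ s, x ^ p i := by
  classical
  induction s using Finset.induction_on with
  | empty => simp
  | insert a t ha ih =>
    obtain ⟨hpa, hpt⟩ := (Finset.forall_mem_insert ..).1 hp
    rw [Finset.prod_insert ha, Finset.sum_insert ha,
      ENNReal.rpow_add_of_nonneg _ _ hpa (Finset.sum_nonneg hpt), ih hpt]

theorem prod_rpow_mul_of_sum_eq_one {ι : Type*} {s : Finset ι} {p : ι → ℝ}
    (hp : ∑ i ∈ s, p i = 1) (hp0 : ∀ i ∈ s, 0 ≤ p i) (f : ι → ℝ≥0∞) (x : ℝ≥0∞) :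
    (∏ i ∈ s, f i ^ p i) * x = ∏ i ∈ s, (f i * x) ^ p i := by
  conv_lhs => rw [← ENNReal.rpow_one x, ← hp, rpow_sum_of_nonneg hp0, ← Finset.prod_mul_distrib]
  exact Finset.prod_congr rfl fun i hi => (ENNReal.mul_rpow_of_nonneg _ _ (hp0 i hi)).symm

theorem sum_prod_rpow_le_prod_sum_rpow {ι κ : Type*} (S : Finset κ) (I : Finset ι)
    (f : ι → κ → ℝ≥0∞) {p : ι → ℝ} (hp : ∑ i ∈ I, p i = 1) (hp0 : ∀ i ∈ I, 0 ≤ p i) :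
    ∑ j ∈ S, ∏ i ∈ I, f i j ^ p i ≤ ∏ i ∈ I, (∑ j ∈ S, f i j) ^ p i := by
  let _ : MeasurableSpace S := ⊤
  have := ENNReal.lintegral_prod_norm_pow_le (μ := (Measure.count : Measure S)) I
    (f := fun i j => f i j) (fun i _ => measurable_from_top.aemeasurable) hp hp0
  simp only [lintegral_count, tsum_fintype] at this
  rw [← Finset.sum_coe_sort S]
  simp_rw [← Finset.sum_coe_sort S (fun j => f _ j)]
  exact this

theorem sum_le_mul_sup_of_geometric {ι : Type*} {x : ℝ≥0∞} (hx : x < 1) {b : ι → ℝ≥0∞}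
    {T : Finset ι} (hb : (T : Set ι).Pairwise fun i j => b i ≤ x * b j ∨ b j ≤ x * b i) :
    ∑ i ∈ T, b i ≤ (1 - x)⁻¹ * T.sup b := by
  classical
  induction T using Finset.strongInduction with
  | H T ih =>
    rcases T.eq_empty_or_nonempty with rfl | hne
    · simp
    obtain ⟨M, hM, hmax⟩ := T.exists_max_image b hne
    have herase : (T.erase M).sup b ≤ x * b M := by
      refine Finset.sup_le fun R hR => ?_
      have hRT := Finset.mem_of_mem_erase hR
      rcases hb hRT hM (Finset.ne_of_mem_erase hR) with h | h
      · exact h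
      · exact (hmax R hRT).trans (h.trans (mul_le_mul_right (hmax R hRT) x))
    have hinv : (1 - x)⁻¹ * (1 - x) = 1 :=
      ENNReal.inv_mul_cancel (tsub_pos_of_lt hx).ne' (ENNReal.sub_ne_top ENNReal.one_ne_top)
    calc ∑ i ∈ T, b i = b M + ∑ i ∈ T.erase M, b i := (Finset.add_sum_erase T b hM).symm
      _ ≤ b M + (1 - x)⁻¹ * (x * b M) := by
        gcongr
        refine (ih _ (Finset.erase_ssubset hM) (hb.mono ?_)).trans (by gcongr)
        exact_mod_cast T.erase_subset M
      _ = (1 - x)⁻¹ * ((1 - x) + x) * b M := by rw [mul_add, hinv]; ring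
      _ = (1 - x)⁻¹ * b M := by rw [tsub_add_cancel_of_le hx.le, mul_one]
      _ ≤ (1 - x)⁻¹ * T.sup b := by gcongr; exact Finset.le_sup hM

theorem le_rpow_of_le_mul_rpow {r r' : ℝ} (hr : r.HolderConjugate r') {a Y : ℝ≥0∞} (hY : Y ≠ ∞)
    (h : Y ≤ a * Y ^ (1 / r')) : Y ≤ a ^ r := by
  rcases eq_or_ne Y 0 with rfl | hY0
  · exact zero_le
  have hsplit : Y ^ (1 / r) * Y ^ (1 / r') = Y := by
    rw [← ENNReal.rpow_add _ _ hY0 hY, one_div, one_div, hr.inv_add_inv_eq_one, ENNReal.rpow_one]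
  have hroot : Y ^ (1 / r) ≤ a := by
    refine (ENNReal.mul_le_mul_iff_left (c := Y ^ (1 / r')) ?_ ?_).1 (hsplit.trans_le h)
    · simp [ENNReal.rpow_eq_zero_iff, hY0, hY]
    · exact ENNReal.rpow_ne_top_of_nonneg hr.symm.one_div_nonneg hY
  rwa [one_div, ENNReal.rpow_inv_le_iff hr.pos] at hroot

section Laminar

variable {X : Type*} [MeasurableSpace X]

/-- A finite laminar family: measurable sets of positive finite `μ`-measure, any two of which are
nested or disjoint. Finite subfamilies of a dyadic grid have this structure. -/
structure IsLaminarFamily (μ : Measure X) (F : Finset (Set X)) : Prop where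
  nested_or_disjoint : ∀ Q ∈ F, ∀ R ∈ F, Q ⊆ R ∨ R ⊆ Q ∨ Disjoint Q R
  measurableSet : ∀ Q ∈ F, MeasurableSet Q
  measure_ne_zero : ∀ Q ∈ F, μ Q ≠ 0
  measure_ne_top : ∀ Q ∈ F, μ Q ≠ ∞

theorem IsLaminarFamily.mono {μ : Measure X} {F S : Finset (Set X)} (hF : IsLaminarFamily μ F)
    (h : S ⊆ F) : IsLaminarFamily μ S where
  nested_or_disjoint Q hQ R hR := hF.nested_or_disjoint Q (h hQ) R (h hR)
  measurableSet Q hQ := hF.measurableSet Q (h hQ)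
  measure_ne_zero Q hQ := hF.measure_ne_zero Q (h hQ)
  measure_ne_top Q hQ := hF.measure_ne_top Q (h hQ)

theorem IsLaminarFamily.exists_disjoint_cover {μ : Measure X} {S : Finset (Set X)}
    (hS : IsLaminarFamily μ S) :
    ∃ T ⊆ S, (T : Set (Set X)).PairwiseDisjoint id ∧ ⋃₀ (S : Set (Set X)) ⊆ ⋃ Q ∈ T, Q := by
  classical
  refine ⟨S.filter (Maximal (· ∈ S)), Finset.filter_subset _ _, fun Q hQ R hR hne => ?_, ?_⟩
  · obtain ⟨hQS, hQmax⟩ := Finset.mem_filter.1 hQ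
    obtain ⟨hRS, hRmax⟩ := Finset.mem_filter.1 hR
    rcases hS.nested_or_disjoint Q hQS R hRS with h | h | h
    · exact absurd (hQmax.eq_of_le hRS h) hne
    · exact absurd (hRmax.eq_of_le hQS h).symm hne
    · exact h
  · rintro x ⟨Q, hQ, hxQ⟩
    obtain ⟨R, hQR, hR⟩ := S.exists_le_maximal hQ
    exact Set.mem_biUnion (Finset.mem_coe.2 (Finset.mem_filter.2 ⟨hR.1, hR⟩)) (hQR hxQ)

/-- The part of `Q` not covered by the strictly smaller members of `S`. -/
def ownPart (S : Finset (Set X)) (Q : Set X) : Set X :=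
  Q \ ⋃₀ {R | R ∈ S ∧ R ⊂ Q}

theorem IsLaminarFamily.disjoint_ownPart {μ : Measure X} {S : Finset (Set X)}
    (hS : IsLaminarFamily μ S) {Q R : Set X} (hQ : Q ∈ S) (hR : R ∈ S) (hne : Q ≠ R) :
    Disjoint (ownPart S Q) (ownPart S R) := by
  have hlt : ∀ Q ∈ S, ∀ R, Q ⊂ R → Disjoint (ownPart S Q) (ownPart S R) := fun Q hQ R h =>
    Set.disjoint_left.2 fun x hx hx' => hx'.2 ⟨Q, ⟨hQ, h⟩, hx.1⟩
  rcases hS.nested_or_disjoint Q hQ R hR with h | h | h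
  · exact hlt Q hQ R (h.ssubset_of_ne hne)
  · exact (hlt R hR Q (h.ssubset_of_ne hne.symm)).symm
  · exact h.mono Set.sdiff_subset Set.sdiff_subset

theorem IsLaminarFamily.measurableSet_ownPart {μ : Measure X} {S : Finset (Set X)}
    (hS : IsLaminarFamily μ S) {Q : Set X} (hQ : Q ∈ S) : MeasurableSet (ownPart S Q) :=
  (hS.measurableSet Q hQ).diff <| .sUnion
    (S.finite_toSet.subset fun _ hR => hR.1).countable fun R hR => hS.measurableSet R hR.1

variable {ι : Type*} [Fintype ι]

/-- The product of the averages of the measures `φ i` over `Q` with respect to `μ`. -/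
noncomputable def avgProd (μ : Measure X) (φ : ι → Measure X) (Q : Set X) : ℝ≥0∞ :=
  ∏ i, φ i Q / μ Q

theorem avgProd_rpow_inv_card_mul [Nonempty ι] {μ : Measure X} (φ : ι → Measure X) {Q : Set X}
    (hQ0 : μ Q ≠ 0) (hQT : μ Q ≠ ∞) :
    avgProd μ φ Q ^ (Fintype.card ι : ℝ)⁻¹ * μ Q = ∏ i, φ i Q ^ (Fintype.card ι : ℝ)⁻¹ := by
  have hc : (0 : ℝ) ≤ (Fintype.card ι : ℝ)⁻¹ := by positivity
  rw [avgProd, ← ENNReal.prod_rpow_of_nonneg hc,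
    prod_rpow_mul_of_sum_eq_one (by simp) fun _ _ => hc]
  simp only [ENNReal.div_mul_cancel hQ0 hQT]

theorem two_mul_sum_measure_le_of_avgProd_growth [Nonempty ι] {μ : Measure X}
    {φ : ι → Measure X} {T : Finset (Set X)} (hT : IsLaminarFamily μ T)
    (hdisj : (T : Set (Set X)).PairwiseDisjoint id) {R : Set X} (hR0 : μ R ≠ 0) (hRT : μ R ≠ ∞)
    (hTR : ∀ Q ∈ T, Q ⊆ R)
    (hgrowth : ∀ Q ∈ T, 2 ^ Fintype.card ι * avgProd μ φ R < avgProd μ φ Q) :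
    2 * ∑ Q ∈ T, μ Q ≤ μ R := by
  rcases T.eq_empty_or_nonempty with rfl | ⟨Q₀, hQ₀⟩
  · simp
  have hc : (0 : ℝ) < (Fintype.card ι : ℝ)⁻¹ := by positivity
  let mean (Q : Set X) : ℝ≥0∞ := avgProd μ φ Q ^ (Fintype.card ι : ℝ)⁻¹
  have hmean_mul : ∀ Q, μ Q ≠ 0 → μ Q ≠ ∞ →
      mean Q * μ Q = ∏ i, φ i Q ^ (Fintype.card ι : ℝ)⁻¹ := fun _ =>
    avgProd_rpow_inv_card_mul φ
  have hmean : ∀ Q ∈ T, 2 * mean R < mean Q := fun Q hQ => by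
    have := ENNReal.rpow_lt_rpow (hgrowth Q hQ) hc
    rwa [ENNReal.mul_rpow_of_nonneg _ _ hc.le,
      ENNReal.pow_rpow_inv_natCast Fintype.card_ne_zero] at this
  have hmeanT : mean R ≠ ∞ := fun h => by simpa [h] using hmean Q₀ hQ₀
  have hmean0 : mean R ≠ 0 := fun h => by
    have hpos : 0 < mean Q₀ * μ Q₀ :=
      ENNReal.mul_pos (hmean Q₀ hQ₀).ne_bot (hT.measure_ne_zero Q₀ hQ₀)
    have hle : mean Q₀ * μ Q₀ ≤ mean R * μ R := by
      rw [hmean_mul Q₀ (hT.measure_ne_zero Q₀ hQ₀) (hT.measure_ne_top Q₀ hQ₀),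
        hmean_mul R hR0 hRT]
      gcongr with i
      exact hTR Q₀ hQ₀
    simp [h, hpos.ne'] at hle
  refine (ENNReal.mul_le_mul_iff_right hmean0 hmeanT).1 ?_
  calc mean R * (2 * ∑ Q ∈ T, μ Q) = ∑ Q ∈ T, 2 * mean R * μ Q := by
        rw [← Finset.mul_sum]; ring
    _ ≤ ∑ Q ∈ T, mean Q * μ Q := by gcongr with Q hQ; exact (hmean Q hQ).le
    _ = ∑ Q ∈ T, ∏ i, φ i Q ^ (Fintype.card ι : ℝ)⁻¹ := Finset.sum_congr rfl fun Q hQ =>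
        hmean_mul Q (hT.measure_ne_zero Q hQ) (hT.measure_ne_top Q hQ)
    _ ≤ ∏ i, (∑ Q ∈ T, φ i Q) ^ (Fintype.card ι : ℝ)⁻¹ :=
        sum_prod_rpow_le_prod_sum_rpow T Finset.univ (fun i Q => φ i Q) (by simp)
          fun _ _ => hc.le
    _ ≤ ∏ i, φ i R ^ (Fintype.card ι : ℝ)⁻¹ := by
        gcongr with i
        exact (measure_biUnion_finset (f := id) hdisj hT.measurableSet).symm.trans_le
          (measure_mono (Set.iUnion₂_subset hTR))
    _ = mean R * μ R := (hmean_mul R hR0 hRT).symm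

theorem IsLaminarFamily.measure_le_two_mul_ownPart [Nonempty ι] {μ : Measure X}
    {φ : ι → Measure X} {S : Finset (Set X)} (hS : IsLaminarFamily μ S)
    (hgrowth : ∀ Q ∈ S, ∀ R ∈ S, Q < R → 2 ^ Fintype.card ι * avgProd μ φ R < avgProd μ φ Q)
    {R : Set X} (hR : R ∈ S) : μ R ≤ 2 * μ (ownPart S R) := by
  classical
  have hsub : S.filter (· ⊂ R) ⊆ S := Finset.filter_subset _ _
  have hset : {Q | Q ∈ S ∧ Q ⊂ R} = (S.filter (· ⊂ R) : Set (Set X)) := by ext; simp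
  obtain ⟨T, hT, hdisj, hcover⟩ := (hS.mono hsub).exists_disjoint_cover
  have hhalf : 2 * ∑ Q ∈ T, μ Q ≤ μ R :=
    two_mul_sum_measure_le_of_avgProd_growth (hS.mono (hT.trans hsub)) hdisj
      (hS.measure_ne_zero R hR) (hS.measure_ne_top R hR)
      (fun Q hQ => (Finset.mem_filter.1 (hT hQ)).2.subset)
      (fun Q hQ => hgrowth Q (hsub (hT hQ)) R hR (Finset.mem_filter.1 (hT hQ)).2)
  have hsplit : μ R ≤ ∑ Q ∈ T, μ Q + μ (ownPart S R) := calc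
    μ R ≤ μ (⋃₀ {Q | Q ∈ S ∧ Q ⊂ R}) + μ (ownPart S R) := by
      refine (measure_mono ?_).trans (measure_union_le _ _)
      rw [ownPart, Set.union_sdiff_self]
      exact Set.subset_union_right
    _ ≤ ∑ Q ∈ T, μ Q + μ (ownPart S R) := by
      rw [hset]
      gcongr
      exact (measure_mono hcover).trans (measure_biUnion_finset_le _ _)
  refine (ENNReal.add_le_add_iff_left (hS.measure_ne_top R hR)).1 ?_
  calc μ R + μ R ≤ 2 * (∑ Q ∈ T, μ Q + μ (ownPart S R)) := by rw [← two_mul]; gcongr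
    _ ≤ μ R + 2 * μ (ownPart S R) := by rw [mul_add]; gcongr

open Classical in
theorem IsLaminarFamily.sum_measure_le_two_mul_lintegral {μ σ : Measure X} {S : Finset (Set X)}
    (hS : IsLaminarFamily μ S) (hown : ∀ Q ∈ S, μ Q ≤ 2 * μ (ownPart S Q)) {R : Set X}
    {g : X → ℝ≥0∞} (hg : ∀ Q ∈ S, Q ⊆ R → ∀ x ∈ Q, σ Q / μ Q ≤ g x) :
    ∑ Q ∈ S with Q ⊆ R, σ Q ≤ 2 * ∫⁻ x in R, g x ∂μ := by
  have hown_le : ∀ Q ∈ S, Q ⊆ R → σ Q ≤ 2 * ∫⁻ x in ownPart S Q, g x ∂μ := fun Q hQ hQR => calc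
    σ Q = σ Q / μ Q * μ Q :=
      (ENNReal.div_mul_cancel (hS.measure_ne_zero Q hQ) (hS.measure_ne_top Q hQ)).symm
    _ ≤ σ Q / μ Q * (2 * μ (ownPart S Q)) := by gcongr; exact hown Q hQ
    _ = 2 * ∫⁻ _ in ownPart S Q, σ Q / μ Q ∂μ := by rw [setLIntegral_const]; ring
    _ ≤ 2 * ∫⁻ x in ownPart S Q, g x ∂μ := mul_le_mul_right
      (setLIntegral_mono' (hS.measurableSet_ownPart hQ) fun x hx => hg Q hQ hQR x hx.1) _
  calc ∑ Q ∈ S with Q ⊆ R, σ Q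
      ≤ ∑ Q ∈ S with Q ⊆ R, 2 * ∫⁻ x in ownPart S Q, g x ∂μ :=
        Finset.sum_le_sum fun Q hQ => (Finset.mem_filter.1 hQ).elim (hown_le Q)
    _ = 2 * ∫⁻ x in ⋃ Q ∈ S.filter (· ⊆ R), ownPart S Q, g x ∂μ := by
        rw [← Finset.mul_sum, lintegral_biUnion_finset]
        · exact fun Q hQ R hR => hS.disjoint_ownPart (Finset.mem_filter.1 hQ).1
            (Finset.mem_filter.1 hR).1
        · exact fun Q hQ => hS.measurableSet_ownPart (Finset.mem_filter.1 hQ).1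
    _ ≤ 2 * ∫⁻ x in R, g x ∂μ := by
        gcongr
        exact Set.iUnion₂_subset fun Q hQ => Set.sdiff_subset.trans (Finset.mem_filter.1 hQ).2

theorem lintegral_sum_indicator_const {μ : Measure X} {T : Finset (Set X)}
    (hT : ∀ Q ∈ T, MeasurableSet Q) (c : Set X → ℝ≥0∞) :
    ∫⁻ x, ∑ Q ∈ T, Q.indicator (fun _ => c Q) x ∂μ = ∑ Q ∈ T, c Q * μ Q := by
  rw [lintegral_finsetSum _ fun Q hQ => measurable_const.indicator (hT Q hQ)]
  exact Finset.sum_congr rfl fun Q hQ => lintegral_indicator_const (hT Q hQ) _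

theorem sum_indicator_rpow_sub_one_le {α : Type*} {T : Finset (Set α)} {A : Set α → ℝ≥0∞}
    (hT : ∀ Q ∈ T, ∀ R ∈ T, Q ⊆ R ∨ R ⊆ Q ∨ Disjoint Q R)
    (hgrowth : ∀ Q ∈ T, ∀ R ∈ T, Q < R → 2 * A R < A Q) {r r' : ℝ} (hr : r.HolderConjugate r')
    (x : α) :
    ∑ Q ∈ T, Q.indicator (fun _ => A Q ^ (r - 1)) x ≤
      (1 - 2⁻¹ ^ (r - 1))⁻¹ * (∑ Q ∈ T, Q.indicator (fun _ => A Q ^ r) x) ^ (1 / r') := by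
  classical
  have hr1 : 0 < r - 1 := sub_pos.2 hr.lt
  have hfilter : ∀ e : ℝ, ∑ Q ∈ T, Q.indicator (fun _ => A Q ^ e) x =
      ∑ Q ∈ T with x ∈ Q, A Q ^ e := fun e => by
    simp only [Finset.sum_filter, Set.indicator_apply]
  rw [hfilter, hfilter]
  have hdecay : ∀ Q ∈ T, ∀ R ∈ T, Q < R → A R ^ (r - 1) ≤ 2⁻¹ ^ (r - 1) * A Q ^ (r - 1) := by
    intro Q hQ R hR hQR
    rw [← ENNReal.mul_rpow_of_nonneg _ _ hr1.le]
    gcongr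
    rw [← ENNReal.mul_le_iff_le_inv two_ne_zero ENNReal.ofNat_ne_top]
    exact (hgrowth Q hQ R hR hQR).le
  have hexp : ∀ a : ℝ≥0∞, a ^ (r - 1) = (a ^ r) ^ (1 / r') := fun a => by
    rw [← ENNReal.rpow_mul, mul_one_div, hr.div_conj_eq_sub_one]
  refine (sum_le_mul_sup_of_geometric (ENNReal.rpow_lt_one
    (ENNReal.inv_lt_one.2 ENNReal.one_lt_two) hr1) ?_).trans ?_
  · intro Q hQ R hR hne
    obtain ⟨hQT, hxQ⟩ := Finset.mem_filter.1 hQ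
    obtain ⟨hRT, hxR⟩ := Finset.mem_filter.1 hR
    rcases hT Q hQT R hRT with h | h | h
    · exact Or.inr (hdecay Q hQT R hRT (h.ssubset_of_ne hne))
    · exact Or.inl (hdecay R hRT Q hQT (h.ssubset_of_ne hne.symm))
    · exact absurd hxR (Set.disjoint_left.1 h hxQ)
  · gcongr
    refine Finset.sup_le fun Q hQ => ?_
    rw [hexp]
    have := hr.symm.one_div_nonneg
    gcongr
    exact Finset.single_le_sum (f := fun Q => A Q ^ r) (fun _ _ => zero_le) hQ

theorem sum_measure_mul_setLAverage_rpow {σ : Measure X} {T : Finset (Set X)}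
    (hT : IsLaminarFamily σ T) {h : X → ℝ≥0∞} (hh : AEMeasurable h σ) {r : ℝ} (hr : 1 < r) :
    ∑ Q ∈ T, σ Q * (⨍⁻ x in Q, h x ∂σ) ^ r =
      ∫⁻ x, h x * ∑ Q ∈ T, Q.indicator (fun _ => (⨍⁻ y in Q, h y ∂σ) ^ (r - 1)) x ∂σ := by
  simp_rw [Finset.mul_sum]
  refine Eq.trans (Finset.sum_congr rfl fun Q hQ => ?_) (lintegral_finsetSum' _ fun Q hQ =>
    hh.mul (measurable_const.indicator (hT.measurableSet Q hQ)).aemeasurable).symm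
  have hpow : (⨍⁻ x in Q, h x ∂σ) ^ r = (⨍⁻ x in Q, h x ∂σ) * (⨍⁻ x in Q, h x ∂σ) ^ (r - 1) := by
    nth_rw 2 [← ENNReal.rpow_one (⨍⁻ x in Q, h x ∂σ)]
    rw [← ENNReal.rpow_add_of_nonneg _ _ zero_le_one (by linarith), add_sub_cancel]
  calc σ Q * (⨍⁻ x in Q, h x ∂σ) ^ r
      = (∫⁻ x in Q, h x ∂σ) * (⨍⁻ x in Q, h x ∂σ) ^ (r - 1) := by
        rw [hpow, ← mul_assoc, measure_mul_setLAverage _ (hT.measure_ne_top Q hQ)]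
    _ = ∫⁻ x, Q.indicator (fun x => h x * (⨍⁻ y in Q, h y ∂σ) ^ (r - 1)) x ∂σ := by
        rw [lintegral_indicator (hT.measurableSet Q hQ), lintegral_mul_const'' _ hh.restrict]
    _ = _ := by simp only [Set.indicator_mul_right, Pi.mul_apply]

theorem setLAverage_ne_top_of_lintegral_rpow {σ : Measure X} {Q : Set X} (hQ0 : σ Q ≠ 0)
    (hQT : σ Q ≠ ∞) {h : X → ℝ≥0∞} {r : ℝ} (hr : 1 ≤ r) (hh : ∫⁻ x, h x ^ r ∂σ ≠ ∞) :
    ⨍⁻ x in Q, h x ∂σ ≠ ∞ := by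
  have hle : ∀ x, h x ≤ 1 + h x ^ r := fun x => by
    rcases le_total (h x) 1 with h1 | h1
    · exact h1.trans le_self_add
    · exact (ENNReal.rpow_one (h x)).symm.trans_le
        ((ENNReal.rpow_le_rpow_of_exponent_le h1 hr).trans le_add_self)
  have hint : ∫⁻ x in Q, h x ∂σ ≤ σ Q + ∫⁻ x, h x ^ r ∂σ := calc
    ∫⁻ x in Q, h x ∂σ ≤ ∫⁻ x in Q, 1 + h x ^ r ∂σ := lintegral_mono hle
    _ = σ Q + ∫⁻ x in Q, h x ^ r ∂σ := by
      rw [lintegral_add_left measurable_const, setLIntegral_one]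
    _ ≤ σ Q + ∫⁻ x, h x ^ r ∂σ := by gcongr; exact Measure.restrict_le_self
  rw [setLAverage_eq]
  exact ENNReal.div_ne_top (ne_top_of_le_ne_top (ENNReal.add_ne_top.2 ⟨hQT, hh⟩) hint) hQ0

/-- The constant of the Carleson embedding `sum_measure_mul_setLAverage_rpow_le`. -/
noncomputable def carlesonConst (r : ℝ) : ℝ≥0∞ :=
  (2 * (1 - 2⁻¹ ^ (r - 1))⁻¹) ^ r

theorem carlesonConst_ne_top {r : ℝ} (hr : 1 < r) : carlesonConst r ≠ ∞ := by
  have hlt : (2⁻¹ : ℝ≥0∞) ^ (r - 1) < 1 :=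
    ENNReal.rpow_lt_one (ENNReal.inv_lt_one.2 ENNReal.one_lt_two) (by linarith)
  exact ENNReal.rpow_ne_top_of_nonneg (by linarith)
    (ENNReal.mul_ne_top ENNReal.ofNat_ne_top (ENNReal.inv_ne_top.2 (tsub_pos_of_lt hlt).ne'))

theorem sum_principal_setLAverage_rpow_le {σ : Measure X} {T : Finset (Set X)}
    (hT : IsLaminarFamily σ T) {h : X → ℝ≥0∞} (hh : AEMeasurable h σ)
    (hgrowth : ∀ Q ∈ T, ∀ R ∈ T, Q < R → 2 * ⨍⁻ x in R, h x ∂σ < ⨍⁻ x in Q, h x ∂σ)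
    {r : ℝ} (hr : 1 < r) :
    ∑ Q ∈ T, σ Q * (⨍⁻ x in Q, h x ∂σ) ^ r ≤
      (1 - 2⁻¹ ^ (r - 1))⁻¹ ^ r * ∫⁻ x, h x ^ r ∂σ := by
  have hconj := Real.HolderConjugate.conjExponent hr
  set r' := r.conjExponent
  set c : ℝ≥0∞ := (1 - 2⁻¹ ^ (r - 1))⁻¹
  have hc0 : c ≠ 0 := ENNReal.inv_ne_zero.2 (ENNReal.sub_ne_top ENNReal.one_ne_top)
  rcases eq_or_ne (∫⁻ x, h x ^ r ∂σ) ∞ with hT' | hfin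
  · rw [hT', ENNReal.mul_top (by simp [ENNReal.rpow_eq_zero_iff, hc0, hconj.nonneg])]
    exact le_top
  set A : Set X → ℝ≥0∞ := fun Q => ⨍⁻ x in Q, h x ∂σ
  set B : X → ℝ≥0∞ := fun x => ∑ Q ∈ T, Q.indicator (fun _ => A Q ^ r) x
  set Y := ∑ Q ∈ T, σ Q * A Q ^ r
  have hY : Y ≠ ∞ := ENNReal.sum_ne_top.2 fun Q hQ => ENNReal.mul_ne_top (hT.measure_ne_top Q hQ)
    (ENNReal.rpow_ne_top_of_nonneg hconj.nonneg (setLAverage_ne_top_of_lintegral_rpow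
      (hT.measure_ne_zero Q hQ) (hT.measure_ne_top Q hQ) hr.le hfin))
  have hB : Measurable fun x => B x ^ (1 / r') := (Finset.measurable_fun_sum _ fun Q hQ =>
    measurable_const.indicator (hT.measurableSet Q hQ)).pow_const _
  have hBint : ∫⁻ x, (B x ^ (1 / r')) ^ r' ∂σ = Y := by
    simp only [one_div, ENNReal.rpow_inv_rpow hconj.symm.ne_zero, B, Y, mul_comm (σ _),
      lintegral_sum_indicator_const hT.measurableSet]
  rw [← ENNReal.rpow_inv_rpow hconj.ne_zero (∫⁻ x, h x ^ r ∂σ),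
    ← ENNReal.mul_rpow_of_nonneg _ _ hconj.nonneg, ← one_div]
  refine le_rpow_of_le_mul_rpow hconj hY ?_
  calc Y = ∫⁻ x, h x * ∑ Q ∈ T, Q.indicator (fun _ => A Q ^ (r - 1)) x ∂σ :=
        sum_measure_mul_setLAverage_rpow hT hh hr
    _ ≤ ∫⁻ x, c * (h x * B x ^ (1 / r')) ∂σ := lintegral_mono fun x =>
        (mul_le_mul_right (sum_indicator_rpow_sub_one_le hT.nested_or_disjoint hgrowth hconj x)
          _).trans_eq (mul_left_comm _ _ _)
    _ = c * ∫⁻ x, h x * B x ^ (1 / r') ∂σ := lintegral_const_mul'' _ (hh.mul hB.aemeasurable)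
    _ ≤ c * ((∫⁻ x, h x ^ r ∂σ) ^ (1 / r) * Y ^ (1 / r')) := by
        have := ENNReal.lintegral_mul_le_Lp_mul_Lq σ hconj hh hB.aemeasurable
        rw [hBint] at this
        gcongr
        exact this
    _ = c * (∫⁻ x, h x ^ r ∂σ) ^ (1 / r) * Y ^ (1 / r') := (mul_assoc _ _ _).symm

open Classical in
theorem sum_measure_mul_setLAverage_rpow_le {σ : Measure X} {S : Finset (Set X)}
    (hS : IsLaminarFamily σ S) {h : X → ℝ≥0∞} (hh : AEMeasurable h σ) {r : ℝ} (hr : 1 < r)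
    {Λ : ℝ≥0∞} (hΛ : ∀ R ∈ S, ∑ Q ∈ S with Q ⊆ R, σ Q ≤ Λ * σ R) :
    ∑ Q ∈ S, σ Q * (⨍⁻ x in Q, h x ∂σ) ^ r ≤ carlesonConst r * Λ * ∫⁻ x, h x ^ r ∂σ := by
  set A : Set X → ℝ≥0∞ := fun Q => ⨍⁻ x in Q, h x ∂σ
  have hr0 : 0 ≤ r := by linarith
  obtain ⟨T, hTS, hgrowth, hcover⟩ := exists_principal_subfamily A one_le_two S
  calc ∑ Q ∈ S, σ Q * A Q ^ r
      ≤ ∑ Q ∈ S, ∑ R ∈ T, if Q ⊆ R then σ Q * (2 * A R) ^ r else 0 := by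
        refine Finset.sum_le_sum fun Q hQ => ?_
        obtain ⟨R, hR, hQR, hle⟩ := hcover Q hQ
        calc σ Q * A Q ^ r ≤ if Q ⊆ R then σ Q * (2 * A R) ^ r else 0 := by
              rw [if_pos hQR]; gcongr
          _ ≤ _ := Finset.single_le_sum
              (f := fun R => if Q ⊆ R then σ Q * (2 * A R) ^ r else 0) (fun _ _ => zero_le) hR
    _ = ∑ R ∈ T, (∑ Q ∈ S with Q ⊆ R, σ Q) * (2 * A R) ^ r := by
        rw [Finset.sum_comm]
        simp only [Finset.sum_mul, Finset.sum_filter, ite_mul, zero_mul]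
    _ ≤ ∑ R ∈ T, Λ * σ R * (2 * A R) ^ r := by
        gcongr with R hR
        exact hΛ R (hTS hR)
    _ = 2 ^ r * Λ * ∑ R ∈ T, σ R * A R ^ r := by
        rw [Finset.mul_sum]
        refine Finset.sum_congr rfl fun R _ => ?_
        rw [ENNReal.mul_rpow_of_nonneg _ _ hr0]
        ring
    _ ≤ 2 ^ r * Λ * ((1 - 2⁻¹ ^ (r - 1))⁻¹ ^ r * ∫⁻ x, h x ^ r ∂σ) := by
        gcongr
        exact sum_principal_setLAverage_rpow_le (hS.mono hTS) hh hgrowth hr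
    _ = carlesonConst r * Λ * ∫⁻ x, h x ^ r ∂σ := by
        rw [carlesonConst, ENNReal.mul_rpow_of_nonneg _ _ hr0]
        ring

theorem avgProd_withDensity {μ : Measure X} {σ : ι → Measure X} (h : ι → X → ℝ≥0∞) {Q : Set X}
    (hQ : MeasurableSet Q) (hσT : ∀ i, σ i Q ≠ ∞) :
    avgProd μ (fun i => (σ i).withDensity (h i)) Q =
      ∏ i, σ i Q / μ Q * ⨍⁻ x in Q, h i x ∂σ i :=
  Finset.prod_congr rfl fun i _ => by
    rw [withDensity_apply _ hQ, ← measure_mul_setLAverage _ (hσT i), ENNReal.mul_div_right_comm]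

theorem avgProd_withDensity_rpow_mul_le {μ ν : Measure X} {σ : ι → Measure X}
    (h : ι → X → ℝ≥0∞) {r : ι → ℝ} (hr : ∀ i, 1 < r i) {q : ℝ} (hq : 0 ≤ q)
    (hqr : ∑ i, q / r i = 1) {K : ℝ≥0∞} {Q : Set X} (hQ : MeasurableSet Q) (hQ0 : μ Q ≠ 0)
    (hQT : μ Q ≠ ∞) (hσT : ∀ i, σ i Q ≠ ∞)
    (hK : (∏ i, (σ i Q / μ Q) ^ (q / (r i).conjExponent)) * (ν Q / μ Q) ≤ K) :
    avgProd μ (fun i => (σ i).withDensity (h i)) Q ^ q * ν Q ≤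
      K * ∏ i, (σ i Q * (⨍⁻ x in Q, h i x ∂σ i) ^ r i) ^ (q / r i) := by
  have hconj := fun i => Real.HolderConjugate.conjExponent (hr i)
  have hqr0 : ∀ i, 0 ≤ q / r i := fun i => div_nonneg hq (hconj i).nonneg
  have hqr' : ∀ i, q = q / (r i).conjExponent + q / r i := fun i => by
    rw [div_eq_mul_inv, div_eq_mul_inv, ← mul_add, add_comm, (hconj i).inv_add_inv_eq_one, mul_one]
  have hfactor : ∀ i (a t : ℝ≥0∞),
      (t * a) ^ q = t ^ (q / (r i).conjExponent) * (t * a ^ r i) ^ (q / r i) := fun i a t => by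
    rw [ENNReal.mul_rpow_of_nonneg _ _ hq, ENNReal.mul_rpow_of_nonneg _ _ (hqr0 i),
      ← ENNReal.rpow_mul, mul_div_cancel₀ _ (hconj i).ne_zero, ← mul_assoc,
      ← ENNReal.rpow_add_of_nonneg _ _ (div_nonneg hq (hconj i).symm.nonneg) (hqr0 i), ← hqr']
  rw [avgProd_withDensity h hQ hσT, ← ENNReal.prod_rpow_of_nonneg hq,
    Finset.prod_congr rfl fun i _ => hfactor i _ _, Finset.prod_mul_distrib]
  calc _ = (∏ i, (σ i Q / μ Q) ^ (q / (r i).conjExponent)) * (ν Q / μ Q) *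
        ((∏ i, (σ i Q / μ Q * (⨍⁻ x in Q, h i x ∂σ i) ^ r i) ^ (q / r i)) * μ Q) := by
        conv_lhs => rw [← ENNReal.div_mul_cancel (a := μ Q) (b := ν Q) hQ0 hQT]
        ring
    _ ≤ K * ((∏ i, (σ i Q / μ Q * (⨍⁻ x in Q, h i x ∂σ i) ^ r i) ^ (q / r i)) * μ Q) := by
        gcongr
    _ = K * ∏ i, (σ i Q * (⨍⁻ x in Q, h i x ∂σ i) ^ r i) ^ (q / r i) := by
        rw [prod_rpow_mul_of_sum_eq_one hqr fun i _ => hqr0 i]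
        simp only [mul_right_comm _ _ (μ Q), ENNReal.div_mul_cancel hQ0 hQT]

/-- The maximal function of a set function `A` over the finite family `F`. -/
noncomputable def laminarMaximal (F : Finset (Set X)) (A : Set X → ℝ≥0∞) (x : X) : ℝ≥0∞ :=
  F.sup fun Q => Q.indicator (fun _ => A Q) x

theorem measurable_laminarMaximal {F : Finset (Set X)} (hF : ∀ Q ∈ F, MeasurableSet Q)
    (A : Set X → ℝ≥0∞) : Measurable (laminarMaximal F A) := by
  simp only [funext (fun x => laminarMaximal.eq_def F A x), Finset.sup_eq_iSup]
  exact Measurable.biSup _ F.countable_toSet fun Q hQ => measurable_const.indicator (hF Q hQ)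

/-- A Fujii–Wilson condition for `σ` over the finite family `F`: on each `R ∈ F` some majorant of
the averages of `σ` over the members of `F` inside `R` has integral at most `Λ * σ R`. -/
def HasFujiiWilsonBound (μ σ : Measure X) (F : Finset (Set X)) (Λ : ℝ≥0∞) : Prop :=
  ∀ R ∈ F, ∃ g : X → ℝ≥0∞, (∀ Q ∈ F, Q ⊆ R → ∀ x ∈ Q, σ Q / μ Q ≤ g x) ∧
    ∫⁻ x in R, g x ∂μ ≤ Λ * σ R

open Classical in
theorem HasFujiiWilsonBound.sum_measure_le {μ σ : Measure X} {F S : Finset (Set X)} {Λ : ℝ≥0∞}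
    (hσ : HasFujiiWilsonBound μ σ F Λ) (hS : IsLaminarFamily μ S) (hSF : S ⊆ F)
    (hown : ∀ Q ∈ S, μ Q ≤ 2 * μ (ownPart S Q)) {R : Set X} (hR : R ∈ S) :
    ∑ Q ∈ S with Q ⊆ R, σ Q ≤ 2 * Λ * σ R := by
  obtain ⟨g, hg, hgR⟩ := hσ R (hSF hR)
  rw [mul_assoc]
  exact (hS.sum_measure_le_two_mul_lintegral hown fun Q hQ => hg Q (hSF hQ)).trans
    (mul_le_mul_right hgR 2)

theorem laminarMaximal_rpow_le_sum {α : Type*} {F S : Finset (Set α)} {A : Set α → ℝ≥0∞}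
    {a : ℝ≥0∞} (hS : ∀ Q ∈ F, ∃ R ∈ S, Q ≤ R ∧ A Q ≤ a * A R) {q : ℝ} (hq : 0 < q) (x : α) :
    laminarMaximal F A x ^ q ≤ ∑ Q ∈ S, Q.indicator (fun _ => a ^ q * A Q ^ q) x := by
  rw [laminarMaximal, Finset.apply_sup_eq_sup_comp_of_linearOrder (· ^ q)
    (ENNReal.monotone_rpow_of_nonneg hq.le) (ENNReal.zero_rpow_of_pos hq)]
  refine Finset.sup_le fun Q hQ => ?_
  obtain ⟨R, hR, hQR, hle⟩ := hS Q hQ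
  refine le_trans ?_ (Finset.single_le_sum
    (f := fun R => R.indicator (fun _ => a ^ q * A R ^ q) x) (fun _ _ => zero_le) hR)
  by_cases hx : x ∈ Q
  · simp only [Function.comp_apply, Set.indicator_of_mem hx, Set.indicator_of_mem (hQR hx)]
    rw [← ENNReal.mul_rpow_of_nonneg _ _ hq.le]
    gcongr
  · simp [Set.indicator_of_notMem hx, hq]

theorem lintegral_laminarMaximal_rpow_le [Nonempty ι] {μ ν : Measure X} {σ : ι → Measure X}
    {h : ι → X → ℝ≥0∞} (hh : ∀ i, AEMeasurable (h i) (σ i)) {r : ι → ℝ} (hr : ∀ i, 1 < r i)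
    {q : ℝ} (hq : 0 < q) (hqr : ∑ i, q / r i = 1) {F : Finset (Set X)}
    (hF : IsLaminarFamily μ F) (hFσ : ∀ i, IsLaminarFamily (σ i) F) {K : ℝ≥0∞}
    (hK : ∀ Q ∈ F, (∏ i, (σ i Q / μ Q) ^ (q / (r i).conjExponent)) * (ν Q / μ Q) ≤ K)
    {Λ : ι → ℝ≥0∞} (hΛ : ∀ i, HasFujiiWilsonBound μ (σ i) F (Λ i)) :
    ∫⁻ x, laminarMaximal F (avgProd μ fun i => (σ i).withDensity (h i)) x ^ q ∂ν ≤
      (2 ^ Fintype.card ι) ^ q * K *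
        ∏ i, (carlesonConst (r i) * (2 * Λ i) * ∫⁻ x, h i x ^ r i ∂σ i) ^ (q / r i) := by
  classical
  set P : Set X → ℝ≥0∞ := avgProd μ fun i => (σ i).withDensity (h i)
  obtain ⟨S, hSF, hgrowth, hcover⟩ := exists_principal_subfamily P
    (a := 2 ^ Fintype.card ι) (one_le_pow₀ one_le_two) F
  have hS := hF.mono hSF
  have hqr0 : ∀ i, 0 ≤ q / r i := fun i => div_nonneg hq.le (by linarith [hr i])
  have hpacking : ∀ i, ∀ R ∈ S, ∑ Q ∈ S with Q ⊆ R, σ i Q ≤ 2 * Λ i * σ i R := fun i _ hR =>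
    (hΛ i).sum_measure_le hS hSF (fun _ => hS.measure_le_two_mul_ownPart hgrowth) hR
  calc ∫⁻ x, laminarMaximal F P x ^ q ∂ν
      ≤ ∫⁻ x, ∑ Q ∈ S, Q.indicator (fun _ => (2 ^ Fintype.card ι) ^ q * P Q ^ q) x ∂ν :=
        lintegral_mono (laminarMaximal_rpow_le_sum hcover hq)
    _ = (2 ^ Fintype.card ι) ^ q * ∑ Q ∈ S, P Q ^ q * ν Q := by
        rw [lintegral_sum_indicator_const hS.measurableSet, Finset.mul_sum]
        simp only [mul_assoc]
    _ ≤ (2 ^ Fintype.card ι) ^ q * ∑ Q ∈ S,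
          K * ∏ i, (σ i Q * (⨍⁻ x in Q, h i x ∂σ i) ^ r i) ^ (q / r i) := by
        refine mul_le_mul_right (Finset.sum_le_sum fun Q hQ => ?_) _
        exact avgProd_withDensity_rpow_mul_le h hr hq.le hqr (hS.measurableSet Q hQ)
          (hS.measure_ne_zero Q hQ) (hS.measure_ne_top Q hQ)
          (fun i => (hFσ i).measure_ne_top Q (hSF hQ)) (hK Q (hSF hQ))
    _ ≤ (2 ^ Fintype.card ι) ^ q * (K * ∏ i, (∑ Q ∈ S,
          σ i Q * (⨍⁻ x in Q, h i x ∂σ i) ^ r i) ^ (q / r i)) := by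
        rw [← Finset.mul_sum]
        gcongr
        exact sum_prod_rpow_le_prod_sum_rpow S Finset.univ
          (fun i Q => σ i Q * (⨍⁻ x in Q, h i x ∂σ i) ^ r i) hqr fun i _ => hqr0 i
    _ ≤ _ := by
        rw [← mul_assoc]
        gcongr with i
        · exact hqr0 i
        · exact sum_measure_mul_setLAverage_rpow_le ((hFσ i).mono hSF) (hh i) (hr i) (hpacking i)

end Laminar

/-- The offset, relative to the side length `2 ^ K`, at scale `K` of the standard grid of dyadic
intervals (`α = false`) or of its one-third shift (`α = true`). The sign alternates with `K` so
that the intervals of the shifted grid are nested. -/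
noncomputable def gridOffset (α : Bool) (K : ℤ) : ℝ := if α then (-1) ^ K / 3 else 0

/-- The index of the dyadic interval of length `2 ^ K` of the (shifted) grid containing `t`. -/
noncomputable def gridIndex (α : Bool) (K : ℤ) (t : ℝ) : ℤ := ⌊t / 2 ^ K - gridOffset α K⌋

theorem gridOffset_succ (α : Bool) (K : ℤ) : gridOffset α (K + 1) = -gridOffset α K := by
  cases α
  · simp [gridOffset]
  · simp [gridOffset, zpow_add_one₀, neg_div]

theorem exists_three_mul_gridOffset_true (K : ℤ) :
    ∃ ε : ℤ, 3 * gridOffset true K = ε ∧ (ε = 1 ∨ ε = -1) := by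
  rcases Int.even_or_odd K with hK | hK
  · exact ⟨1, by simp [gridOffset, hK.neg_one_zpow], Or.inl rfl⟩
  · exact ⟨-1, by norm_num [gridOffset, hK.neg_one_zpow], Or.inr rfl⟩

theorem exists_three_mul_gridOffset (α : Bool) (K : ℤ) : ∃ ε : ℤ, 3 * gridOffset α K = ε := by
  cases α
  · exact ⟨0, by simp [gridOffset]⟩
  · exact (exists_three_mul_gridOffset_true K).imp fun _ h => h.1

theorem gridIndex_mono (α : Bool) (K : ℤ) : Monotone (gridIndex α K) := fun s t h =>
  Int.floor_le_floor (by gcongr)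

theorem gridIndex_eq_iff {α : Bool} {K c : ℤ} {t : ℝ} :
    gridIndex α K t = c ↔ 2 ^ K * (c + gridOffset α K) ≤ t ∧
      t < 2 ^ K * (c + gridOffset α K) + 2 ^ K := by
  have h2 : (0 : ℝ) < 2 ^ K := by positivity
  rw [gridIndex, Int.floor_eq_iff, le_sub_iff_add_le, sub_lt_iff_lt_add, le_div_iff₀ h2,
    div_lt_iff₀ h2, mul_comm (2 ^ K : ℝ), add_right_comm, add_mul _ 1, one_mul]

theorem exists_gridIndex_succ_eq (α : Bool) (K : ℤ) :
    ∃ ε : ℤ, ∀ t, gridIndex α (K + 1) t = (gridIndex α K t + ε) / 2 := by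
  obtain ⟨ε, hε⟩ := exists_three_mul_gridOffset α K
  refine ⟨ε, fun t => ?_⟩
  have hhalf : t / 2 ^ (K + 1) - gridOffset α (K + 1) =
      (t / 2 ^ K - gridOffset α K + ε) / (2 : ℕ) := by
    rw [gridOffset_succ, ← hε, zpow_add_one₀ two_ne_zero]
    push_cast
    ring
  rw [gridIndex, hhalf, Int.floor_div_natCast, Int.floor_add_intCast]
  rfl

theorem gridIndex_congr_of_le {α : Bool} {K L : ℤ} (hKL : K ≤ L) {s t : ℝ}
    (h : gridIndex α K s = gridIndex α K t) : gridIndex α L s = gridIndex α L t := by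
  induction L, hKL using Int.leInduction with
  | base => exact h
  | succ L _ ih =>
    obtain ⟨ε, hε⟩ := exists_gridIndex_succ_eq α L
    rw [hε, hε, ih]

theorem exists_gridIndex_eq {K : ℤ} {a b : ℝ} (hab : a ≤ b) (h : b - a ≤ 2 ^ K / 3) :
    ∃ α, gridIndex α K a = gridIndex α K b := by
  by_contra! hne
  obtain ⟨ε, hε, hε'⟩ := exists_three_mul_gridOffset_true K
  -- Both grids have a point in `(a, b]`, but points of distinct grids are `≥ 2 ^ K / 3` apart.
  have hpoint : ∀ α, a / 2 ^ K < gridIndex α K b + gridOffset α K ∧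
      gridIndex α K b + gridOffset α K ≤ b / 2 ^ K := fun α =>
    ⟨sub_lt_iff_lt_add.1 (Int.floor_lt.1 ((gridIndex_mono α K hab).lt_of_ne (hne α))),
      le_sub_iff_add_le.1 (Int.floor_le _)⟩
  have hshort : b / 2 ^ K - a / 2 ^ K ≤ 1 / 3 := by
    rw [← sub_div, div_le_iff₀ (by positivity)]
    linarith
  obtain ⟨hfalse, hfalse'⟩ := hpoint false
  obtain ⟨htrue, htrue'⟩ := hpoint true
  have hzero : gridOffset false K = 0 := rfl
  generalize gridIndex false K b = i at hfalse hfalse'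
  generalize gridIndex true K b = j at htrue htrue'
  have hlt : ((3 * (i - j) - ε : ℤ) : ℝ) < (1 : ℤ) := by push_cast; linarith
  have hgt : ((-1 : ℤ) : ℝ) < (3 * (i - j) - ε : ℤ) := by push_cast; linarith
  rw [Int.cast_lt] at hlt hgt
  omega

section Cubes

variable {n : ℕ}

theorem volume_setOf_forall_mem (s : Fin n → Set ℝ) :
    volume {x : EuclideanSpace ℝ (Fin n) | ∀ j, x j ∈ s j} = ∏ j, volume (s j) := by
  rw [← volume_pi_pi,
    ← (EuclideanSpace.volume_preserving_symm_measurableEquiv_toLp (Fin n)).measure_preimage_equiv]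
  congr 1
  ext x
  simp

theorem measurableSet_setOf_forall_mem {s : Fin n → Set ℝ} (hs : ∀ j, MeasurableSet (s j)) :
    MeasurableSet {x : EuclideanSpace ℝ (Fin n) | ∀ j, x j ∈ s j} := by
  rw [Set.ofPred_forall]
  exact MeasurableSet.iInter fun j => hs j |>.preimage (by fun_prop)

theorem volume_closedCube (a : EuclideanSpace ℝ (Fin n)) (l : ℝ) :
    volume {x : EuclideanSpace ℝ (Fin n) | ∀ j, a j ≤ x j ∧ x j ≤ a j + l} =
      ENNReal.ofReal l ^ n := by
  simpa using volume_setOf_forall_mem fun j => Set.Icc (a j) (a j + l)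

theorem IsCube.measurableSet {Q : Set (EuclideanSpace ℝ (Fin n))} (hQ : IsCube Q) :
    MeasurableSet Q := by
  obtain ⟨a, l, -, rfl⟩ := hQ
  exact measurableSet_setOf_forall_mem fun j => measurableSet_Icc (a := a j) (b := a j + l)

theorem IsCube.volume_ne_zero {Q : Set (EuclideanSpace ℝ (Fin n))} (hQ : IsCube Q) :
    volume Q ≠ 0 := by
  obtain ⟨a, l, hl, rfl⟩ := hQ
  rw [volume_closedCube]
  exact pow_ne_zero _ (by simpa using hl)

theorem IsCube.volume_ne_top {Q : Set (EuclideanSpace ℝ (Fin n))} (hQ : IsCube Q) :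
    volume Q ≠ ∞ := by
  obtain ⟨a, l, -, rfl⟩ := hQ
  rw [volume_closedCube]
  exact ENNReal.pow_ne_top ENNReal.ofReal_ne_top

/-- The half-open dyadic cube of side `2 ^ d.1` and index `d.2` of the grid whose `j`-th coordinate
is shifted according to `α j`. -/
def gridCell (α : Fin n → Bool) (d : ℤ × (Fin n → ℤ)) : Set (EuclideanSpace ℝ (Fin n)) :=
  {x | ∀ j, gridIndex (α j) d.1 (x j) = d.2 j}

theorem gridCell_eq (α : Fin n → Bool) (d : ℤ × (Fin n → ℤ)) :
    gridCell α d = {x | ∀ j, x j ∈ Set.Ico (2 ^ d.1 * (d.2 j + gridOffset (α j) d.1))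
      (2 ^ d.1 * (d.2 j + gridOffset (α j) d.1) + 2 ^ d.1)} := by
  ext x
  simp [gridCell, gridIndex_eq_iff]

theorem volume_gridCell (α : Fin n → Bool) (d : ℤ × (Fin n → ℤ)) :
    volume (gridCell α d) = ENNReal.ofReal (2 ^ d.1) ^ n := by
  rw [gridCell_eq, volume_setOf_forall_mem]
  simp

theorem measurableSet_gridCell (α : Fin n → Bool) (d : ℤ × (Fin n → ℤ)) :
    MeasurableSet (gridCell α d) := by
  rw [gridCell_eq]
  exact measurableSet_setOf_forall_mem fun _ => measurableSet_Ico

theorem exists_isCube_ae_eq_gridCell (α : Fin n → Bool) (d : ℤ × (Fin n → ℤ)) :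
    ∃ R, IsCube R ∧ gridCell α d ⊆ R ∧ gridCell α d =ᵐ[volume] R := by
  set a : EuclideanSpace ℝ (Fin n) :=
    WithLp.toLp 2 fun j => 2 ^ d.1 * (d.2 j + gridOffset (α j) d.1)
  have hR : IsCube {x | ∀ j, a j ≤ x j ∧ x j ≤ a j + 2 ^ d.1} :=
    ⟨a, 2 ^ d.1, by positivity, rfl⟩
  have hsub : gridCell α d ⊆ {x | ∀ j, a j ≤ x j ∧ x j ≤ a j + 2 ^ d.1} := by
    rw [gridCell_eq]
    exact fun x hx j => ⟨(hx j).1, (hx j).2.le⟩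
  refine ⟨_, hR, hsub, ae_eq_of_subset_of_measure_ge hsub ?_
    (measurableSet_gridCell α d).nullMeasurableSet hR.volume_ne_top⟩
  rw [volume_closedCube, volume_gridCell]

theorem gridCell_subset_or_disjoint (α : Fin n → Bool) {d e : ℤ × (Fin n → ℤ)}
    (hde : d.1 ≤ e.1) : gridCell α d ⊆ gridCell α e ∨ Disjoint (gridCell α d) (gridCell α e) := by
  refine or_iff_not_imp_right.2 fun h => ?_
  obtain ⟨x, hxd, hxe⟩ := Set.not_disjoint_iff.1 h
  intro y hy j
  rw [← hxe j]
  exact gridIndex_congr_of_le hde ((hy j).trans (hxd j).symm)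

open Classical in
theorem isLaminarFamily_image_gridCell {α : Fin n → Bool}
    {μ : Measure (EuclideanSpace ℝ (Fin n))} (h0 : ∀ d, μ (gridCell α d) ≠ 0)
    (hT : ∀ d, μ (gridCell α d) ≠ ∞) (F : Finset (ℤ × (Fin n → ℤ))) :
    IsLaminarFamily μ (F.image (gridCell α)) where
  nested_or_disjoint := by
    simp only [Finset.forall_mem_image]
    intro d _ e _
    rcases le_total d.1 e.1 with h | h
    · exact (gridCell_subset_or_disjoint α h).imp_right Or.inr
    · exact Or.inr ((gridCell_subset_or_disjoint α h).imp_right fun h => h.symm)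
  measurableSet := by simpa only [Finset.forall_mem_image] using
    fun d _ => measurableSet_gridCell α d
  measure_ne_zero := by simpa only [Finset.forall_mem_image] using fun d _ => h0 d
  measure_ne_top := by simpa only [Finset.forall_mem_image] using fun d _ => hT d

theorem IsCube.exists_subset_gridCell {Q : Set (EuclideanSpace ℝ (Fin n))} (hQ : IsCube Q) :
    ∃ (α : Fin n → Bool) (d : ℤ × (Fin n → ℤ)), Q ⊆ gridCell α d ∧
      volume (gridCell α d) ≤ 6 ^ n * volume Q := by
  obtain ⟨a, l, hl, rfl⟩ := hQ
  obtain ⟨K, hK1, hK2⟩ := exists_mem_Ioc_zpow (x := 3 * l) (y := (2 : ℝ)) (by positivity)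
    one_lt_two
  have hα : ∀ j, ∃ α, gridIndex α (K + 1) (a j) = gridIndex α (K + 1) (a j + l) := fun j =>
    exists_gridIndex_eq (by linarith) (by linarith)
  choose α hα using hα
  refine ⟨α, (K + 1, fun j => gridIndex (α j) (K + 1) (a j)), fun x hx j => ?_, ?_⟩
  · exact le_antisymm ((gridIndex_mono _ _ (hx j).2).trans (hα j).ge) (gridIndex_mono _ _ (hx j).1)
  · have hside : (2 : ℝ) ^ (K + 1) ≤ 6 * l := by
      rw [zpow_add_one₀ two_ne_zero]
      linarith
    rw [volume_gridCell, volume_closedCube, ← mul_pow]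
    gcongr
    exact (ENNReal.ofReal_le_ofReal hside).trans_eq (by simp [ENNReal.ofReal_mul])

theorem IsCube.exists_exhaustion {Q : Set (EuclideanSpace ℝ (Fin n))} (hQ : IsCube Q) :
    ∃ R : ℕ → Set (EuclideanSpace ℝ (Fin n)), (∀ N, IsCube (R N)) ∧ (∀ N, Q ⊆ R N) ∧
      ⋃ N, R N = Set.univ := by
  obtain ⟨a, l, hl, rfl⟩ := hQ
  let c (N : ℕ) : EuclideanSpace ℝ (Fin n) := WithLp.toLp 2 fun j => a j - N
  refine ⟨fun N => {x | ∀ j, c N j ≤ x j ∧ x j ≤ c N j + (l + 2 * N)},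
    fun N => ⟨c N, l + 2 * N, by positivity, rfl⟩, fun N x hx j => ?_, ?_⟩
  · constructor <;> simp only [c] <;> linarith [(hx j).1, (hx j).2, N.cast_nonneg (α := ℝ)]
  · refine Set.eq_univ_of_forall fun x => Set.mem_iUnion.2 ?_
    obtain ⟨N, hN⟩ := exists_nat_ge (∑ j, |x j - a j|)
    refine ⟨N, fun j => ?_⟩
    have hj := abs_le.1 ((Finset.single_le_sum (f := fun j => |x j - a j|)
      (fun _ _ => abs_nonneg _) (Finset.mem_univ j)).trans hN)
    constructor <;> simp only [c] <;> linarith [hj.1, hj.2]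

theorem exists_isCube (n : ℕ) : ∃ Q : Set (EuclideanSpace ℝ (Fin n)), IsCube Q :=
  ⟨_, 0, 1, one_pos, rfl⟩

theorem cubeAvg_eq_div (Q : Set (EuclideanSpace ℝ (Fin n)))
    (g : EuclideanSpace ℝ (Fin n) → ℝ≥0∞) : cubeAvg Q g = (∫⁻ y in Q, g y) / volume Q := by
  rw [cubeAvg, mul_comm, div_eq_mul_inv]

theorem withDensity_div_volume_eq_cubeAvg {Q R : Set (EuclideanSpace ℝ (Fin n))}
    (hQ : MeasurableSet Q) (hQR : Q =ᵐ[volume] R) (g : EuclideanSpace ℝ (Fin n) → ℝ≥0∞) :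
    volume.withDensity g Q / volume Q = cubeAvg R g := by
  rw [cubeAvg_eq_div, withDensity_apply _ hQ, setLIntegral_congr hQR, measure_congr hQR]

theorem IsCube.cubeAvg_le_hlMaximal {Q : Set (EuclideanSpace ℝ (Fin n))} (hQ : IsCube Q)
    (g : EuclideanSpace ℝ (Fin n) → ℝ≥0∞) {x : EuclideanSpace ℝ (Fin n)} (hx : x ∈ Q) :
    cubeAvg Q g ≤ hlMaximal g x :=
  le_iSup_of_le Q (le_iSup₂_of_le hQ hx le_rfl)

theorem IsCube.lintegral_hlMaximal_le_aInftyConst {Q : Set (EuclideanSpace ℝ (Fin n))}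
    (hQ : IsCube Q) {σ : EuclideanSpace ℝ (Fin n) → ℝ≥0∞} (h0 : ∫⁻ x in Q, σ x ≠ 0)
    (hT : ∫⁻ x in Q, σ x ≠ ∞) :
    ∫⁻ x in Q, hlMaximal (Q.indicator σ) x ≤ aInftyConst σ * ∫⁻ x in Q, σ x :=
  (ENNReal.div_le_iff h0 hT).1 <| le_iSup₂ (f := fun (Q : Set (EuclideanSpace ℝ (Fin n)))
    (_ : IsCube Q) => (∫⁻ x in Q, hlMaximal (Q.indicator σ) x) / ∫⁻ x in Q, σ x) Q hQ

open Classical in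
theorem hasFujiiWilsonBound_image_gridCell {σ : EuclideanSpace ℝ (Fin n) → ℝ≥0∞}
    (h0 : ∀ Q, IsCube Q → ∫⁻ x in Q, σ x ≠ 0) (hT : ∀ Q, IsCube Q → ∫⁻ x in Q, σ x ≠ ∞)
    (α : Fin n → Bool) (F : Finset (ℤ × (Fin n → ℤ))) :
    HasFujiiWilsonBound volume (volume.withDensity σ) (F.image (gridCell α))
      (aInftyConst σ) := by
  simp only [HasFujiiWilsonBound, Finset.forall_mem_image]
  intro d _
  obtain ⟨R, hR, hdR, hdR_ae⟩ := exists_isCube_ae_eq_gridCell α d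
  refine ⟨hlMaximal (R.indicator σ), fun e _ hed x hx => ?_, ?_⟩
  · obtain ⟨R', hR', heR', heR'_ae⟩ := exists_isCube_ae_eq_gridCell α e
    have hlocal : volume.withDensity σ (gridCell α e) =
        volume.withDensity (R.indicator σ) (gridCell α e) := by
      rw [withDensity_apply _ (measurableSet_gridCell α e),
        withDensity_apply _ (measurableSet_gridCell α e)]
      exact setLIntegral_congr_fun (measurableSet_gridCell α e) fun y hy =>
        (Set.indicator_of_mem (hdR (hed hy)) σ).symm
    rw [hlocal, withDensity_div_volume_eq_cubeAvg (measurableSet_gridCell α e) heR'_ae]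
    exact hR'.cubeAvg_le_hlMaximal _ (heR' hx)
  · rw [withDensity_apply _ (measurableSet_gridCell α d), setLIntegral_congr hdR_ae,
      setLIntegral_congr hdR_ae]
    exact hR.lintegral_hlMaximal_le_aInftyConst (h0 R hR) (hT R hR)

theorem ae_of_forall_isCube_ae_restrict {p : EuclideanSpace ℝ (Fin n) → Prop}
    (h : ∀ Q, IsCube Q → ∀ᵐ x ∂volume.restrict Q, p x) : ∀ᵐ x, p x := by
  obtain ⟨Q, hQ⟩ := exists_isCube n
  obtain ⟨R, hR, -, hU⟩ := hQ.exists_exhaustion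
  rw [← Measure.restrict_univ (μ := volume), ← hU, ae_restrict_iUnion_eq, Filter.eventually_iSup]
  exact fun N => h (R N) (hR N)

theorem withDensity_withDensity_div {X : Type*} [MeasurableSpace X] {μ : Measure X}
    {v g : X → ℝ≥0∞} (hv : AEMeasurable v μ) (hg : AEMeasurable g μ) (hv0 : ∀ᵐ x ∂μ, v x ≠ 0)
    (hvT : ∀ᵐ x ∂μ, v x ≠ ∞) :
    (μ.withDensity v).withDensity (g / v) = μ.withDensity g := by
  rw [← withDensity_mul₀ hv (hg.div hv)]
  refine withDensity_congr_ae ?_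
  filter_upwards [hv0, hvT] with x hx0 hxT
  exact ENNReal.mul_div_cancel hx0 hxT

section DualWeight

variable {r : ℝ} {w : EuclideanSpace ℝ (Fin n) → ℝ≥0}

theorem aemeasurable_dualWeight (hw : AEMeasurable w volume) :
    AEMeasurable (dualWeight r w) volume := hw.coe_nnreal_ennreal.pow_const _

theorem dualWeight_ne_zero (hr : 1 < r) (x : EuclideanSpace ℝ (Fin n)) :
    dualWeight r w x ≠ 0 := by
  have hexp := (Real.HolderConjugate.conjExponent hr).symm.lt
  simp [dualWeight, ENNReal.rpow_eq_zero_iff, hexp.le]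

theorem dualWeight_rpow_one_sub (hr : 1 < r) (x : EuclideanSpace ℝ (Fin n)) :
    dualWeight r w x ^ (1 - r) = w x := by
  have hexp : (1 - r.conjExponent) * (1 - r) = 1 := by
    have hr0 : r - 1 ≠ 0 := by linarith
    rw [Real.conjExponent]
    field_simp
    ring
  rw [dualWeight, ← ENNReal.rpow_mul, hexp, ENNReal.rpow_one]

theorem dualWeight_mul_div_rpow (hr : 1 < r) {x : EuclideanSpace ℝ (Fin n)}
    (hT : dualWeight r w x ≠ ∞) (y : ℝ≥0∞) :
    dualWeight r w x * (y / dualWeight r w x) ^ r = y ^ r * w x := by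
  rw [ENNReal.div_rpow_of_nonneg _ _ (by linarith), ← dualWeight_rpow_one_sub hr x,
    ENNReal.rpow_sub _ _ (dualWeight_ne_zero hr x) hT, ENNReal.rpow_one, div_eq_mul_inv,
    div_eq_mul_inv]
  ring

theorem setLIntegral_dualWeight_ne_zero (hr : 1 < r) (hw : AEMeasurable w volume)
    {Q : Set (EuclideanSpace ℝ (Fin n))} (hQ : volume Q ≠ 0) :
    ∫⁻ x in Q, dualWeight r w x ≠ 0 := by
  rw [ne_eq, lintegral_eq_zero_iff' (aemeasurable_dualWeight hw).restrict]
  intro h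
  have hfalse : ∀ᵐ _ ∂volume.restrict Q, False := h.mono fun x hx => dualWeight_ne_zero hr x hx
  rw [Filter.eventually_false_iff_eq_bot, ae_eq_bot, Measure.restrict_eq_zero] at hfalse
  exact hQ hfalse

theorem ae_dualWeight_ne_top (hw : AEMeasurable w volume)
    (hloc : ∀ Q, IsCube Q → ∫⁻ x in Q, dualWeight r w x ≠ ∞) :
    ∀ᵐ x, dualWeight r w x ≠ ∞ :=
  ae_of_forall_isCube_ae_restrict fun Q hQ =>
    (ae_lt_top' (aemeasurable_dualWeight hw).restrict (hloc Q hQ)).mono fun _ hx => hx.ne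

theorem lintegral_withDensity_dualWeight_div_rpow (hr : 1 < r) (hw : AEMeasurable w volume)
    (hT : ∀ᵐ x, dualWeight r w x ≠ ∞) {g : EuclideanSpace ℝ (Fin n) → ℝ≥0∞}
    (hg : AEMeasurable g volume) :
    ∫⁻ x, (g x / dualWeight r w x) ^ r ∂volume.withDensity (dualWeight r w) =
      ∫⁻ x, g x ^ r * w x := by
  have hdual : AEMeasurable (dualWeight r w) volume := aemeasurable_dualWeight hw
  have hquot : AEMeasurable (fun x => g x / dualWeight r w x) volume := hg.div hdual
  rw [lintegral_withDensity_eq_lintegral_mul₀ hdual (hquot.pow_const r)]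
  exact lintegral_congr_ae (hT.mono fun x hx => dualWeight_mul_div_rpow hr hx _)

end DualWeight

section ApWeights

variable {m : ℕ} {q : ℝ} {r : Fin m → ℝ} {ω : Fin m → EuclideanSpace ℝ (Fin n) → ℝ≥0}

theorem IsCube.prod_cubeAvg_mul_cubeAvg_le_apConst {Q : Set (EuclideanSpace ℝ (Fin n))}
    (hQ : IsCube Q) (q : ℝ) (r : Fin m → ℝ) (ω : Fin m → EuclideanSpace ℝ (Fin n) → ℝ≥0) :
    (∏ i, cubeAvg Q (dualWeight (r i) (ω i)) ^ (q / Real.conjExponent (r i))) *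
      cubeAvg Q (jointWeight q r ω) ≤ apConst q r ω :=
  le_iSup₂ (f := fun (Q : Set (EuclideanSpace ℝ (Fin n))) (_ : IsCube Q) =>
    (∏ i, cubeAvg Q (dualWeight (r i) (ω i)) ^ (q / Real.conjExponent (r i))) *
      cubeAvg Q (jointWeight q r ω)) Q hQ

theorem setLIntegral_jointWeight_eq_zero (hr : ∀ i, 1 < r i) (hq : 0 < q)
    (hω : ∀ i, AEMeasurable (ω i) volume) (hap : apConst q r ω < ∞)
    {Q : Set (EuclideanSpace ℝ (Fin n))} (hQ : IsCube Q) {i : Fin m}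
    (hi : ∫⁻ x in Q, dualWeight (r i) (ω i) x = ∞) :
    ∫⁻ x in Q, jointWeight q r ω x = 0 := by
  have hexp : ∀ j, 0 < q / Real.conjExponent (r j) := fun j =>
    div_pos hq (Real.HolderConjugate.conjExponent (hr j)).symm.pos
  have havg0 : ∀ j, cubeAvg Q (dualWeight (r j) (ω j)) ≠ 0 := fun j => by
    rw [cubeAvg_eq_div]
    exact ENNReal.div_ne_zero.2
      ⟨setLIntegral_dualWeight_ne_zero (hr j) (hω j) hQ.volume_ne_zero, hQ.volume_ne_top⟩
  have havgT : cubeAvg Q (dualWeight (r i) (ω i)) = ∞ := by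
    rw [cubeAvg_eq_div, hi, ENNReal.top_div_of_ne_top hQ.volume_ne_top]
  have hprod : ∏ j, cubeAvg Q (dualWeight (r j) (ω j)) ^ (q / Real.conjExponent (r j)) = ∞ := by
    rw [← Finset.mul_prod_erase _ _ (Finset.mem_univ i), havgT, ENNReal.top_rpow_of_pos (hexp i),
      ENNReal.top_mul]
    refine Finset.prod_ne_zero_iff.2 fun j _ => ?_
    simp [ENNReal.rpow_eq_zero_iff, havg0 j, (hexp j).le]
  have hle := (hQ.prod_cubeAvg_mul_cubeAvg_le_apConst q r ω).trans_lt hap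
  by_contra hne
  have hjoint : cubeAvg Q (jointWeight q r ω) ≠ 0 := by
    rw [cubeAvg_eq_div]
    exact ENNReal.div_ne_zero.2 ⟨hne, hQ.volume_ne_top⟩
  rw [hprod, ENNReal.top_mul hjoint] at hle
  exact hle.false

theorem withDensity_jointWeight_eq_zero (hr : ∀ i, 1 < r i) (hq : 0 < q)
    (hω : ∀ i, AEMeasurable (ω i) volume) (hap : apConst q r ω < ∞)
    {Q : Set (EuclideanSpace ℝ (Fin n))} (hQ : IsCube Q) {i : Fin m}
    (hi : ∫⁻ x in Q, dualWeight (r i) (ω i) x = ∞) :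
    volume.withDensity (jointWeight q r ω) = 0 := by
  obtain ⟨R, hR, hQR, hU⟩ := hQ.exists_exhaustion
  rw [← Measure.measure_univ_eq_zero, ← hU]
  refine measure_iUnion_null fun N => ?_
  rw [withDensity_apply _ (hR N).measurableSet]
  exact setLIntegral_jointWeight_eq_zero hr hq hω hap (hR N)
    (top_le_iff.1 (hi ▸ lintegral_mono_set (hQR N)))

/-- The unweighted multilinear maximal operator on nonnegative functions,
`sup_{Q ∋ x} ∏ ⟨g_i⟩_Q`. -/
noncomputable def multilinearMaximal (g : Fin m → EuclideanSpace ℝ (Fin n) → ℝ≥0∞)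
    (x : EuclideanSpace ℝ (Fin n)) : ℝ≥0∞ :=
  ⨆ (Q : Set (EuclideanSpace ℝ (Fin n))) (_ : IsCube Q) (_ : x ∈ Q), ∏ i, cubeAvg Q (g i)

/-- The dyadic multilinear maximal operator of the grid with shift `α`. -/
noncomputable def gridMaximal (α : Fin n → Bool) (g : Fin m → EuclideanSpace ℝ (Fin n) → ℝ≥0∞)
    (x : EuclideanSpace ℝ (Fin n)) : ℝ≥0∞ :=
  ⨆ d, (gridCell α d).indicator (fun _ => ∏ i, cubeAvg (gridCell α d) (g i)) x

theorem measurable_gridMaximal (α : Fin n → Bool)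
    (g : Fin m → EuclideanSpace ℝ (Fin n) → ℝ≥0∞) : Measurable (gridMaximal α g) :=
  Measurable.iSup fun d => measurable_const.indicator (measurableSet_gridCell α d)

theorem cubeAvg_le_mul_cubeAvg {Q R : Set (EuclideanSpace ℝ (Fin n))} (hQR : Q ⊆ R)
    {c : ℝ≥0∞} (hc0 : c ≠ 0) (hcT : c ≠ ∞) (hvol : volume R ≤ c * volume Q)
    (g : EuclideanSpace ℝ (Fin n) → ℝ≥0∞) : cubeAvg Q g ≤ c * cubeAvg R g := by
  have hinv : (volume Q)⁻¹ ≤ c * (volume R)⁻¹ := by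
    rw [← div_eq_mul_inv, ENNReal.le_div_iff_mul_le (Or.inr hc0) (Or.inr hcT), mul_comm,
      ← div_eq_mul_inv]
    exact ENNReal.div_le_of_le_mul hvol
  rw [cubeAvg, cubeAvg, ← mul_assoc]
  gcongr

theorem multilinearMaximal_le (g : Fin m → EuclideanSpace ℝ (Fin n) → ℝ≥0∞)
    (x : EuclideanSpace ℝ (Fin n)) :
    multilinearMaximal g x ≤ (6 ^ n) ^ m * ⨆ α, gridMaximal α g x := by
  refine iSup_le fun Q => iSup₂_le fun hQ hx => ?_
  obtain ⟨α, d, hQd, hvol⟩ := hQ.exists_subset_gridCell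
  calc ∏ i, cubeAvg Q (g i)
      ≤ ∏ i, 6 ^ n * cubeAvg (gridCell α d) (g i) := by
        gcongr with i
        exact cubeAvg_le_mul_cubeAvg hQd (by positivity) (by finiteness) hvol (g i)
    _ = (6 ^ n) ^ m * (gridCell α d).indicator
          (fun _ => ∏ i, cubeAvg (gridCell α d) (g i)) x := by
        rw [Finset.prod_mul_distrib, Set.indicator_of_mem (hQd hx)]
        simp
    _ ≤ (6 ^ n) ^ m * ⨆ α, gridMaximal α g x := by
        gcongr
        exact (le_iSup (fun d => (gridCell α d).indicator
          (fun _ => ∏ i, cubeAvg (gridCell α d) (g i)) x) d).trans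
            (le_iSup (fun α => gridMaximal α g x) α)

theorem multilinearMaximal_rpow_le (g : Fin m → EuclideanSpace ℝ (Fin n) → ℝ≥0∞) (hq : 0 ≤ q)
    (x : EuclideanSpace ℝ (Fin n)) :
    multilinearMaximal g x ^ q ≤ ((6 ^ n) ^ m) ^ q * ∑ α, gridMaximal α g x ^ q := by
  obtain ⟨α, hα⟩ := exists_eq_ciSup_of_finite (f := fun α => gridMaximal α g x)
  calc multilinearMaximal g x ^ q
      ≤ ((6 ^ n) ^ m * gridMaximal α g x) ^ q := by
        rw [hα]
        gcongr
        exact multilinearMaximal_le g x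
    _ = ((6 ^ n) ^ m) ^ q * gridMaximal α g x ^ q := ENNReal.mul_rpow_of_nonneg _ _ hq
    _ ≤ _ := mul_le_mul_right (Finset.single_le_sum
        (f := fun α => gridMaximal α g x ^ q) (fun _ _ => zero_le) (Finset.mem_univ α)) _

open Classical in
theorem gridMaximal_eq_iSup_laminarMaximal (α : Fin n → Bool)
    (g : Fin m → EuclideanSpace ℝ (Fin n) → ℝ≥0∞) (x : EuclideanSpace ℝ (Fin n)) :
    gridMaximal α g x = ⨆ F : Finset (ℤ × (Fin n → ℤ)),
      laminarMaximal (F.image (gridCell α))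
        (avgProd volume fun i => volume.withDensity (g i)) x := by
  have havg : ∀ d, avgProd volume (fun i => volume.withDensity (g i)) (gridCell α d) =
      ∏ i, cubeAvg (gridCell α d) (g i) := fun d => Finset.prod_congr rfl fun i _ =>
    withDensity_div_volume_eq_cubeAvg (measurableSet_gridCell α d) ae_eq_rfl (g i)
  simp only [laminarMaximal, Finset.sup_image, Function.comp_def, havg]
  simp only [Finset.sup_eq_iSup]
  exact iSup_eq_iSup_finset _

open Classical in
theorem lintegral_laminarMaximal_image_gridCell_rpow_le [NeZero m] (hr : ∀ i, 1 < r i)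
    (hq : 0 < q) (hqr : ∑ i, q / r i = 1) (hω : ∀ i, AEMeasurable (ω i) volume)
    (hloc : ∀ i, ∀ Q, IsCube Q → ∫⁻ x in Q, dualWeight (r i) (ω i) x ≠ ∞)
    {g : Fin m → EuclideanSpace ℝ (Fin n) → ℝ≥0∞} (hg : ∀ i, AEMeasurable (g i) volume)
    (α : Fin n → Bool) (F : Finset (ℤ × (Fin n → ℤ))) :
    ∫⁻ x, laminarMaximal (F.image (gridCell α))
        (avgProd volume fun i => volume.withDensity (g i)) x ^ q
        ∂volume.withDensity (jointWeight q r ω) ≤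
      (2 ^ m) ^ q * apConst q r ω * ∏ i, (carlesonConst (r i) *
        (2 * aInftyConst (dualWeight (r i) (ω i))) * ∫⁻ x, g i x ^ r i * ω i x) ^ (q / r i) := by
  let σ i := volume.withDensity (dualWeight (r i) (ω i))
  have hdual : ∀ i, AEMeasurable (dualWeight (r i) (ω i)) volume := fun i =>
    aemeasurable_dualWeight (hω i)
  have hdualT : ∀ i, ∀ᵐ x, dualWeight (r i) (ω i) x ≠ ∞ := fun i =>
    ae_dualWeight_ne_top (hω i) (hloc i)
  have hcell : ∀ d, volume (gridCell α d) ≠ 0 ∧ volume (gridCell α d) ≠ ∞ := fun d => by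
    obtain ⟨R, hR, -, hdR⟩ := exists_isCube_ae_eq_gridCell α d
    rw [measure_congr hdR]
    exact ⟨hR.volume_ne_zero, hR.volume_ne_top⟩
  have hσcell : ∀ i d, σ i (gridCell α d) ≠ 0 ∧ σ i (gridCell α d) ≠ ∞ := fun i d => by
    obtain ⟨R, hR, hdR, -⟩ := exists_isCube_ae_eq_gridCell α d
    rw [withDensity_apply _ (measurableSet_gridCell α d)]
    exact ⟨setLIntegral_dualWeight_ne_zero (hr i) (hω i) (hcell d).1,
      ne_top_of_le_ne_top (hloc i R hR) (lintegral_mono_set hdR)⟩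
  have hap : ∀ Q ∈ F.image (gridCell α), (∏ i, (σ i Q / volume Q) ^ (q / (r i).conjExponent)) *
      (volume.withDensity (jointWeight q r ω) Q / volume Q) ≤ apConst q r ω := by
    simp only [Finset.forall_mem_image]
    intro d _
    obtain ⟨R, hR, -, hdR⟩ := exists_isCube_ae_eq_gridCell α d
    simp only [σ, withDensity_div_volume_eq_cubeAvg (measurableSet_gridCell α d) hdR]
    exact hR.prod_cubeAvg_mul_cubeAvg_le_apConst q r ω
  have hmain := lintegral_laminarMaximal_rpow_le (σ := σ)
    (h := fun i => g i / dualWeight (r i) (ω i))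
    (fun i => ((hg i).div (hdual i)).mono_ac (withDensity_absolutelyContinuous _ _)) hr hq hqr
    (isLaminarFamily_image_gridCell (fun d => (hcell d).1) (fun d => (hcell d).2) F)
    (fun i => isLaminarFamily_image_gridCell (fun d => (hσcell i d).1)
      (fun d => (hσcell i d).2) F) hap
    fun i => hasFujiiWilsonBound_image_gridCell
      (fun Q hQ => setLIntegral_dualWeight_ne_zero (hr i) (hω i) hQ.volume_ne_zero) (hloc i) α F
  simpa only [σ, withDensity_withDensity_div (hdual _) (hg _)
    (Filter.Eventually.of_forall (dualWeight_ne_zero (hr _))) (hdualT _), Fintype.card_fin,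
    Pi.div_apply, lintegral_withDensity_dualWeight_div_rpow (hr _) (hω _) (hdualT _) (hg _)]
    using hmain

theorem lintegral_gridMaximal_rpow_le [NeZero m] (hr : ∀ i, 1 < r i)
    (hq : 0 < q) (hqr : ∑ i, q / r i = 1) (hω : ∀ i, AEMeasurable (ω i) volume)
    (hloc : ∀ i, ∀ Q, IsCube Q → ∫⁻ x in Q, dualWeight (r i) (ω i) x ≠ ∞)
    {g : Fin m → EuclideanSpace ℝ (Fin n) → ℝ≥0∞} (hg : ∀ i, AEMeasurable (g i) volume)
    (α : Fin n → Bool) :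
    ∫⁻ x, gridMaximal α g x ^ q ∂volume.withDensity (jointWeight q r ω) ≤
      (2 ^ m) ^ q * apConst q r ω * ∏ i, (carlesonConst (r i) *
        (2 * aInftyConst (dualWeight (r i) (ω i))) * ∫⁻ x, g i x ^ r i * ω i x) ^ (q / r i) := by
  classical
  have hsup : ∀ x, gridMaximal α g x ^ q = ⨆ F : Finset (ℤ × (Fin n → ℤ)),
      laminarMaximal (F.image (gridCell α))
        (avgProd volume fun i => volume.withDensity (g i)) x ^ q := fun x => by
    rw [gridMaximal_eq_iSup_laminarMaximal]
    exact (ENNReal.orderIsoRpow q hq).map_iSup _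
  simp only [hsup]
  rw [lintegral_iSup_directed]
  · exact iSup_le fun F =>
      lintegral_laminarMaximal_image_gridCell_rpow_le hr hq hqr hω hloc hg α F
  · refine fun F => ((measurable_laminarMaximal ?_ _).pow_const q).aemeasurable
    simpa only [Finset.forall_mem_image] using fun d _ => measurableSet_gridCell α d
  · exact Monotone.directed_le fun F G hFG x => ENNReal.rpow_le_rpow
      (Finset.sup_mono (Finset.image_subset_image hFG)) hq.le

variable (n q r) in
/-- The constant in the mixed `A_P`-`A_∞` bound for `multilinearMaximal`: the passage to dyadic
grids, their number, the principal cubes, and the Carleson embeddings. -/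
noncomputable def maximalConst : ℝ≥0∞ :=
  ((6 ^ n) ^ m) ^ q * (2 ^ n * (2 ^ m) ^ q) * ∏ i, (carlesonConst (r i) * 2) ^ (q / r i)

theorem maximalConst_ne_top (hr : ∀ i, 1 < r i) (hq : 0 ≤ q) : maximalConst n q r ≠ ∞ := by
  refine ENNReal.mul_ne_top (ENNReal.mul_ne_top (ENNReal.rpow_ne_top_of_nonneg hq (by finiteness))
    (ENNReal.mul_ne_top (by finiteness) (ENNReal.rpow_ne_top_of_nonneg hq (by finiteness))))
    (ENNReal.prod_ne_top fun i _ => ENNReal.rpow_ne_top_of_nonneg ?_ ?_)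
  · exact div_nonneg hq (by linarith [hr i])
  · exact ENNReal.mul_ne_top (carlesonConst_ne_top (hr i)) ENNReal.ofNat_ne_top

theorem lintegral_multilinearMaximal_rpow_le [NeZero m] (hr : ∀ i, 1 < r i) (hq : 0 < q)
    (hqr : ∑ i, q / r i = 1) (hω : ∀ i, AEMeasurable (ω i) volume) (hap : apConst q r ω < ∞)
    {g : Fin m → EuclideanSpace ℝ (Fin n) → ℝ≥0∞} (hg : ∀ i, AEMeasurable (g i) volume) :
    ∫⁻ x, multilinearMaximal g x ^ q ∂volume.withDensity (jointWeight q r ω) ≤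
      maximalConst n q r * apConst q r ω *
        (∏ i, aInftyConst (dualWeight (r i) (ω i)) ^ (q / r i)) *
        ∏ i, (∫⁻ x, g i x ^ r i * ω i x) ^ (q / r i) := by
  by_cases hloc : ∀ i, ∀ Q, IsCube Q → ∫⁻ x in Q, dualWeight (r i) (ω i) x ≠ ∞
  swap
  · push Not at hloc
    obtain ⟨i, Q, hQ, hi⟩ := hloc
    rw [withDensity_jointWeight_eq_zero hr hq hω hap hQ hi, lintegral_zero_measure]
    exact zero_le
  have hqr0 : ∀ i, 0 ≤ q / r i := fun i => div_nonneg hq.le (by linarith [hr i])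
  have hmeas : ∀ α, Measurable fun x => gridMaximal α g x ^ q := fun α =>
    (measurable_gridMaximal α g).pow_const q
  calc ∫⁻ x, multilinearMaximal g x ^ q ∂volume.withDensity (jointWeight q r ω)
      ≤ ∫⁻ x, ((6 ^ n) ^ m) ^ q * ∑ α, gridMaximal α g x ^ q
          ∂volume.withDensity (jointWeight q r ω) :=
        lintegral_mono (multilinearMaximal_rpow_le g hq.le)
    _ = ((6 ^ n) ^ m) ^ q * ∑ α : Fin n → Bool, ∫⁻ x, gridMaximal α g x ^ q
          ∂volume.withDensity (jointWeight q r ω) := by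
        rw [lintegral_const_mul _ (Finset.measurable_fun_sum _ fun α _ => hmeas α),
          lintegral_finsetSum _ fun α _ => hmeas α]
    _ ≤ ((6 ^ n) ^ m) ^ q * ∑ _α : Fin n → Bool, (2 ^ m) ^ q * apConst q r ω *
          ∏ i, (carlesonConst (r i) * (2 * aInftyConst (dualWeight (r i) (ω i))) *
            ∫⁻ x, g i x ^ r i * ω i x) ^ (q / r i) :=
        mul_le_mul_right (Finset.sum_le_sum fun α _ =>
          lintegral_gridMaximal_rpow_le hr hq hqr hω hloc hg α) _
    _ = _ := by
        simp only [maximalConst, Finset.sum_const, Finset.card_univ, Fintype.card_fun,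
          Fintype.card_bool, Fintype.card_fin, nsmul_eq_mul, Nat.cast_pow, Nat.cast_ofNat,
          ENNReal.mul_rpow_of_nonneg _ _ (hqr0 _), Finset.prod_mul_distrib]
        ring

end ApWeights

end Cubes

section ProductMeasure

theorem lintegral_pi_prod_eq_prod_lintegral {m : ℕ} {X : Fin m → Type*}
    [∀ i, MeasurableSpace (X i)] (μ : ∀ i, Measure (X i)) [∀ i, SigmaFinite (μ i)]
    {f : ∀ i, X i → ℝ≥0∞} (hf : ∀ i, AEMeasurable (f i) (μ i)) :
    ∫⁻ y, ∏ i, f i (y i) ∂Measure.pi μ = ∏ i, ∫⁻ x, f i x ∂μ i := by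
  induction m with
  | zero => simp
  | succ m ih =>
    have htail : AEMeasurable (fun y : ∀ i : Fin m, X i.succ => ∏ i, f i.succ (y i))
        (Measure.pi fun i => μ i.succ) :=
      Finset.aemeasurable_fun_prod _ fun i _ => (hf i.succ).comp_quasiMeasurePreserving
        (Measure.quasiMeasurePreserving_eval (fun i : Fin m => μ i.succ) i)
    rw [Fin.prod_univ_succ, ← ih (fun i => μ i.succ) (fun i => hf i.succ),
      ← lintegral_prod_mul (hf 0) htail]
    simp only [Fin.prod_univ_succ]
    exact ((measurePreserving_piFinSuccAbove μ 0).lintegral_map_equiv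
      fun z => f 0 z.1 * ∏ i : Fin m, f i.succ (z.2 i)).symm

variable {𝕜 : Type*} [NormedField 𝕜] {m : ℕ} {X : Fin m → Type*} [∀ i, MeasurableSpace (X i)]
  {μ : ∀ i, Measure (X i)} [∀ i, SigmaFinite (μ i)] {f : ∀ i, X i → 𝕜}

theorem aestronglyMeasurable_pi_prod (hf : ∀ i, AEStronglyMeasurable (f i) (μ i)) :
    AEStronglyMeasurable (fun y : ∀ i, X i => ∏ i, f i (y i)) (Measure.pi μ) :=
  Finset.aestronglyMeasurable_fun_prod _ fun i _ =>
    (hf i).comp_quasiMeasurePreserving (Measure.quasiMeasurePreserving_eval _ i)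

theorem enorm_finsetProd {ι : Type*} (t : Finset ι) (a : ι → 𝕜) :
    ‖∏ i ∈ t, a i‖ₑ = ∏ i ∈ t, ‖a i‖ₑ := by
  simp only [enorm_eq_nnnorm, nnnorm_prod, ENNReal.ofNNReal_finsetProd]

theorem eLpNorm_pi_prod {s' : ℝ} (hs' : 0 < s') (hf : ∀ i, AEStronglyMeasurable (f i) (μ i)) :
    eLpNorm (fun y : ∀ i, X i => ∏ i, f i (y i)) (ENNReal.ofReal s') (Measure.pi μ) =
      (∏ i, ∫⁻ x, ‖f i x‖ₑ ^ s' ∂μ i) ^ (1 / s') := by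
  rw [eLpNorm_eq_lintegral_rpow_enorm_toReal (by simpa using hs') ENNReal.ofReal_ne_top,
    ENNReal.toReal_ofReal hs'.le]
  simp only [enorm_finsetProd, ← ENNReal.prod_rpow_of_nonneg hs'.le]
  rw [lintegral_pi_prod_eq_prod_lintegral (f := fun i x => ‖f i x‖ₑ ^ s') μ
    fun i => (hf i).enorm.pow_const _]

theorem lintegral_pi_enorm_mul_prod_le {s : ℝ≥0∞} {s' : ℝ} (hs' : 0 < s')
    (hs : s.HolderConjugate (ENNReal.ofReal s')) {Φ : (∀ i, X i) → 𝕜}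
    (hΦ : AEStronglyMeasurable Φ (Measure.pi μ)) (hf : ∀ i, AEStronglyMeasurable (f i) (μ i)) :
    ∫⁻ y, ‖Φ y‖ₑ * ∏ i, ‖f i (y i)‖ₑ ∂Measure.pi μ ≤
      eLpNorm Φ s (Measure.pi μ) * (∏ i, ∫⁻ x, ‖f i x‖ₑ ^ s' ∂μ i) ^ (1 / s') := by
  rw [← eLpNorm_pi_prod hs' hf]
  refine le_trans (le_of_eq ?_)
    (eLpNorm_smul_le_mul_eLpNorm (r := 1) (aestronglyMeasurable_pi_prod hf) hΦ)
  simp only [eLpNorm_one_eq_lintegral_enorm, smul_eq_mul, Pi.mul_apply, enorm_mul,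
    enorm_finsetProd]

end ProductMeasure

section BallBound

variable {E G : Type*} [NormedAddCommGroup E] [NormedSpace ℝ E] [MeasurableSpace E]
  [NormedAddCommGroup G]

/-- `L^s` control of a kernel on balls centred at the origin, with the scaling in the radius of a
function that is homogeneous of degree zero. -/
def HasBallBound (μ : Measure E) (Ω : E → G) (s c N : ℝ≥0∞) : Prop :=
  ∀ R : ℝ, 0 < R → AEStronglyMeasurable Ω (μ.restrict (Metric.ball 0 R)) ∧
    eLpNorm Ω s (μ.restrict (Metric.ball 0 R)) ≤
      (c * ENNReal.ofReal R ^ Module.finrank ℝ E) ^ (1 / s).toReal * N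

theorem HasBallBound.comp_sub_left [BorelSpace E] [SecondCountableTopology E] {μ : Measure E}
    [μ.IsAddLeftInvariant] [μ.IsNegInvariant] {Ω : E → G} {s c N : ℝ≥0∞}
    (hΩ : HasBallBound μ Ω s c N) {R : ℝ} (hR : 0 < R) {T : Set E} {z : E}
    (hT : ∀ y ∈ T, ‖z - y‖ < R) :
    AEStronglyMeasurable (fun y => Ω (z - y)) (μ.restrict T) ∧
      eLpNorm (fun y => Ω (z - y)) s (μ.restrict T) ≤
        (c * ENNReal.ofReal R ^ Module.finrank ℝ E) ^ (1 / s).toReal * N := by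
  have hreflect : MeasurePreserving (fun y => z - y)
      (μ.restrict ((fun y => z - y) ⁻¹' Metric.ball 0 R)) (μ.restrict (Metric.ball 0 R)) :=
    (Measure.measurePreserving_sub_left μ z).restrict_preimage Metric.isOpen_ball.measurableSet
  have hball : T ⊆ (fun y => z - y) ⁻¹' Metric.ball 0 R := fun y hy =>
    mem_ball_zero_iff.2 (hT y hy)
  have hsub := Measure.restrict_mono_set μ hball
  obtain ⟨hmeas, hnorm⟩ := hΩ R hR
  refine ⟨(hmeas.comp_measurePreserving hreflect).mono_measure hsub, ?_⟩
  exact (eLpNorm_mono_measure _ hsub).trans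
    ((eLpNorm_comp_measurePreserving hmeas hreflect).trans_le hnorm)

theorem HasBallBound.of_map_le {Z : Type*} [MeasurableSpace Z] {μ : Measure E} {τ : Measure Z}
    {θ : E → Z} (hθ : Measurable θ) {c : ℝ≥0∞}
    (hmap : ∀ R : ℝ, 0 < R → (μ.restrict (Metric.ball 0 R)).map θ ≤
      (c * ENNReal.ofReal R ^ Module.finrank ℝ E) • τ)
    {Ψ : Z → G} (hΨ : AEStronglyMeasurable Ψ τ) {Ω : E → G} (hΩ : Ω =ᵐ[μ] Ψ ∘ θ) (s : ℝ≥0∞) :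
    HasBallBound μ Ω s c (eLpNorm Ψ s τ) := fun R hR => by
  have hΨmap : AEStronglyMeasurable Ψ ((μ.restrict (Metric.ball 0 R)).map θ) :=
    hΨ.mono_ac (Measure.absolutelyContinuous_of_le_smul (hmap R hR))
  have hΩR : Ω =ᵐ[μ.restrict (Metric.ball 0 R)] Ψ ∘ θ := ae_restrict_of_ae hΩ
  refine ⟨(hΨmap.comp_measurable hθ).congr hΩR.symm, ?_⟩
  rw [eLpNorm_congr_ae hΩR, ← eLpNorm_map_measure hΨmap hθ.aemeasurable]
  exact eLpNorm_le_of_measure_le_smul (hmap R hR)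

end BallBound

section RoughMaximal

variable {n m : ℕ} {s : ℝ≥0∞} {s' : ℝ} {Ω : (Fin m → EuclideanSpace ℝ (Fin n)) → ℂ}
  {f : Fin m → EuclideanSpace ℝ (Fin n) → ℂ} {c N : ℝ≥0∞}

theorem IsCube.exists_radius {Q : Set (EuclideanSpace ℝ (Fin n))} (hQ : IsCube Q) :
    ∃ R : ℝ, 0 < R ∧ (∀ x ∈ Q, ∀ y ∈ Q, ‖x - y‖ < R) ∧
      ENNReal.ofReal R ^ n = (n + 1) ^ n * volume Q := by
  obtain ⟨a, l, hl, rfl⟩ := hQ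
  refine ⟨(n + 1) * l, by positivity, fun x hx y hy => ?_, ?_⟩
  · have hcoord : ∀ j, ‖(x - y) j‖ ≤ l := fun j => by
      rw [PiLp.sub_apply, Real.norm_eq_abs, abs_le]
      constructor <;> linarith [(hx j).1, (hx j).2, (hy j).1, (hy j).2]
    have hsum : ‖x - y‖ ^ 2 ≤ n * l ^ 2 := by
      rw [EuclideanSpace.norm_sq_eq]
      calc ∑ j, ‖(x - y) j‖ ^ 2 ≤ ∑ _j : Fin n, l ^ 2 :=
            Finset.sum_le_sum fun j _ => by gcongr; exact hcoord j
        _ = n * l ^ 2 := by simp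
    refine lt_of_pow_lt_pow_left₀ 2 (by positivity) (hsum.trans_lt ?_)
    rw [mul_pow]
    exact mul_lt_mul_of_pos_right (by nlinarith [n.cast_nonneg (α := ℝ)]) (by positivity)
  · rw [volume_closedCube, ← mul_pow, ENNReal.ofReal_mul (by positivity),
      ENNReal.ofReal_add (by positivity) (by norm_num), ENNReal.ofReal_natCast, ENNReal.ofReal_one]

theorem toReal_one_div_add_one_div (hs' : 0 < s')
    (hs : s.HolderConjugate (ENNReal.ofReal s')) : (1 / s).toReal + 1 / s' = 1 := by
  have h := hs.inv_add_inv_eq_inv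
  have hsT : s⁻¹ ≠ ∞ := fun hT => by simp [hT] at h
  have hreal := congrArg ENNReal.toReal h
  rw [ENNReal.toReal_add hsT (by simpa using hs'), inv_one, ENNReal.toReal_one,
    ENNReal.toReal_inv (ENNReal.ofReal s'), ENNReal.toReal_ofReal hs'.le] at hreal
  rw [one_div, one_div, hreal]

theorem inv_mul_rpow_mul_rpow {V a b : ℝ≥0∞} (hV0 : V ≠ 0) (hVT : V ≠ ∞) {t u : ℝ} (ht : 0 ≤ t)
    (hu : 0 ≤ u) (htu : t + u = 1) : V⁻¹ * ((a * V) ^ t * b ^ u) = a ^ t * (V⁻¹ * b) ^ u := by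
  have hV : V⁻¹ * V ^ t = V⁻¹ ^ u := by
    conv_lhs => rw [← ENNReal.rpow_neg_one, ← ENNReal.rpow_add _ _ hV0 hVT]
    rw [ENNReal.inv_rpow, ← ENNReal.rpow_neg]
    congr 1
    linarith
  rw [ENNReal.mul_rpow_of_nonneg _ _ ht, ENNReal.mul_rpow_of_nonneg _ _ hu, ← hV]
  ring

theorem HasBallBound.cube_average_le (hΩ : HasBallBound volume Ω s c N) (hs' : 0 < s')
    (hs : s.HolderConjugate (ENNReal.ofReal s')) (hf : ∀ i, AEStronglyMeasurable (f i) volume)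
    {Q : Set (EuclideanSpace ℝ (Fin n))} (hQ : IsCube Q) {x : EuclideanSpace ℝ (Fin n)}
    (hx : x ∈ Q) :
    (volume Q ^ m)⁻¹ *
        ∫⁻ y in Set.univ.pi (fun _ : Fin m => Q), ‖Ω (fun i => x - y i)‖ₑ * ∏ i, ‖f i (y i)‖ₑ ≤
      (c * ((n + 1) ^ n) ^ m) ^ (1 / s).toReal * N *
        (∏ i, cubeAvg Q (fun z => ‖f i z‖ₑ ^ s')) ^ (1 / s') := by
  obtain ⟨R, hR, hdiam, hRvol⟩ := hQ.exists_radius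
  have hneg : (volume : Measure (Fin m → EuclideanSpace ℝ (Fin n))).IsNegInvariant :=
    Measure.pi.isNegInvariant _
  obtain ⟨hmeas, hnorm⟩ := hΩ.comp_sub_left (T := Set.univ.pi fun _ => Q) (z := fun _ => x) hR
    fun y hy => (pi_norm_lt_iff hR).2 fun i => hdiam x hx (y i) (hy i (Set.mem_univ i))
  have hscale : c * ENNReal.ofReal R ^ Module.finrank ℝ (Fin m → EuclideanSpace ℝ (Fin n)) =
      c * ((n + 1) ^ n) ^ m * volume Q ^ m := by
    rw [Module.finrank_pi_fintype]
    simp [mul_comm m, pow_mul, hRvol, mul_pow, mul_assoc]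
  rw [hscale] at hnorm
  have hrestrict : (volume : Measure (Fin m → EuclideanSpace ℝ (Fin n))).restrict
      (Set.univ.pi fun _ => Q) = Measure.pi fun _ => volume.restrict Q :=
    Measure.restrict_pi_pi _ _
  rw [hrestrict] at hmeas hnorm ⊢
  have havg : ∏ i, cubeAvg Q (fun z => ‖f i z‖ₑ ^ s') =
      (volume Q ^ m)⁻¹ * ∏ i, ∫⁻ z in Q, ‖f i z‖ₑ ^ s' := by
    simp [cubeAvg, Finset.prod_mul_distrib, ENNReal.inv_pow]
  rw [havg, mul_right_comm, ← inv_mul_rpow_mul_rpow (pow_ne_zero _ hQ.volume_ne_zero)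
    (ENNReal.pow_ne_top hQ.volume_ne_top) ENNReal.toReal_nonneg (by positivity)
    (toReal_one_div_add_one_div hs' hs), mul_assoc, mul_right_comm _ _ N]
  gcongr
  exact (lintegral_pi_enorm_mul_prod_le hs' hs hmeas fun i => (hf i).restrict).trans (by gcongr)

theorem HasBallBound.roughMaximal_le (hΩ : HasBallBound volume Ω s c N) (hs' : 0 < s')
    (hs : s.HolderConjugate (ENNReal.ofReal s')) (hf : ∀ i, AEStronglyMeasurable (f i) volume)
    (x : EuclideanSpace ℝ (Fin n)) :
    roughMaximal Ω f x ≤ (c * ((n + 1) ^ n) ^ m) ^ (1 / s).toReal * N *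
      multilinearMaximal (fun i z => ‖f i z‖ₑ ^ s') x ^ (1 / s') := by
  refine iSup_le fun Q => iSup₂_le fun hQ hx => (hΩ.cube_average_le hs' hs hf hQ hx).trans ?_
  gcongr
  exact le_iSup_of_le Q (le_iSup₂_of_le hQ hx le_rfl)

theorem weightedNorm_eq_lintegral {F : Type*} [ENorm F] (g : EuclideanSpace ℝ (Fin n) → F) {r : ℝ}
    (hr : 0 < r) (w : EuclideanSpace ℝ (Fin n) → ℝ≥0∞) :
    weightedNorm g r w = (∫⁻ x, ‖g x‖ₑ ^ r ∂volume.withDensity w) ^ (1 / r) := by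
  rw [weightedNorm, eLpNorm_eq_lintegral_rpow_enorm_toReal (by simpa using hr)
    ENNReal.ofReal_ne_top, ENNReal.toReal_ofReal hr.le]

theorem weightedNorm_rpow {g : EuclideanSpace ℝ (Fin n) → ℂ} (hg : AEStronglyMeasurable g volume)
    {w : EuclideanSpace ℝ (Fin n) → ℝ≥0} (hw : AEMeasurable w volume) {r : ℝ} (hr : 0 < r)
    (hs' : s' ≠ 0) (p : ℝ) :
    weightedNorm g r (fun x => (w x : ℝ≥0∞)) ^ p =
      (∫⁻ x, (‖g x‖ₑ ^ s') ^ (r / s') * w x) ^ (p / r) := by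
  rw [weightedNorm_eq_lintegral g hr, ← ENNReal.rpow_mul, one_div_mul_eq_div,
    lintegral_withDensity_eq_lintegral_mul₀ hw.coe_nnreal_ennreal (hg.enorm.pow_const _)]
  simp only [← ENNReal.rpow_mul, mul_div_cancel₀ _ hs', Pi.mul_apply, mul_comm]

theorem HasBallBound.weightedNorm_roughMaximal_le_lintegral (hΩ : HasBallBound volume Ω s c N)
    (hc : c ≠ ∞) (hN : N ≠ ∞) (hs' : 0 < s') (hs : s.HolderConjugate (ENNReal.ofReal s'))
    (hf : ∀ i, AEStronglyMeasurable (f i) volume) {p : ℝ} (hp : 0 < p)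
    (w : EuclideanSpace ℝ (Fin n) → ℝ≥0∞) :
    weightedNorm (roughMaximal Ω f) p w ≤ (c * ((n + 1) ^ n) ^ m) ^ (1 / s).toReal * N *
      (∫⁻ x, multilinearMaximal (fun i z => ‖f i z‖ₑ ^ s') x ^ (p / s')
        ∂volume.withDensity w) ^ (1 / p) := by
  set D := (c * ((n + 1) ^ n) ^ m) ^ (1 / s).toReal * N
  have hD : D ≠ ∞ := ENNReal.mul_ne_top (ENNReal.rpow_ne_top_of_nonneg ENNReal.toReal_nonneg
    (ENNReal.mul_ne_top hc (by finiteness))) hN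
  calc weightedNorm (roughMaximal Ω f) p w
      ≤ (∫⁻ x, (D * multilinearMaximal (fun i z => ‖f i z‖ₑ ^ s') x ^ (1 / s')) ^ p
          ∂volume.withDensity w) ^ (1 / p) := by
        rw [weightedNorm_eq_lintegral _ hp]
        gcongr with x
        exact hΩ.roughMaximal_le hs' hs hf x
    _ = _ := by
        simp only [ENNReal.mul_rpow_of_nonneg _ _ hp.le, ← ENNReal.rpow_mul, one_div_mul_eq_div]
        rw [lintegral_const_mul' _ _ (ENNReal.rpow_ne_top_of_nonneg hp.le hD),
          ENNReal.mul_rpow_of_nonneg _ _ (one_div_nonneg.2 hp.le), ← ENNReal.rpow_mul,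
          mul_one_div_cancel hp.ne', ENNReal.rpow_one]

variable {P : Fin m → ℝ} {p : ℝ}

theorem pos_of_one_div_eq_sum [NeZero m] (hP : ∀ i, 0 < P i) (hp : 1 / p = ∑ i, 1 / P i) :
    0 < p := by
  rw [← one_div_pos, hp]
  exact Finset.sum_pos (fun i _ => one_div_pos.2 (hP i)) Finset.univ_nonempty

theorem sum_div_eq_one_of_one_div_eq_sum (hp0 : p ≠ 0) (hp : 1 / p = ∑ i, 1 / P i) :
    ∑ i, p / P i = 1 := by
  simp only [div_eq_mul_one_div p, ← Finset.mul_sum, ← hp, mul_one_div_cancel hp0]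

variable (s s' n c P p) in
/-- The constant in the weighted bound for the rough maximal operator of a kernel whose ball bound
has scaling constant `c`. -/
noncomputable def roughConst : ℝ≥0∞ :=
  (c * ((n + 1) ^ n) ^ m) ^ (1 / s).toReal *
    maximalConst n (p / s') (fun i => P i / s') ^ (1 / p)

theorem roughConst_ne_top (hc : c ≠ ∞) (hs' : 0 < s') (hP : ∀ i, s' < P i) (hp : 0 < p) :
    roughConst n s s' c P p ≠ ∞ :=
  ENNReal.mul_ne_top (ENNReal.rpow_ne_top_of_nonneg ENNReal.toReal_nonneg
    (ENNReal.mul_ne_top hc (by finiteness))) (ENNReal.rpow_ne_top_of_nonneg (by positivity)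
      (maximalConst_ne_top (fun i => (one_lt_div hs').2 (hP i)) (by positivity)))

theorem HasBallBound.weightedNorm_roughMaximal_le [NeZero m] (hΩ : HasBallBound volume Ω s c N)
    (hc : c ≠ ∞) (hN : N ≠ ∞) (hs' : 0 < s') (hs : s.HolderConjugate (ENNReal.ofReal s'))
    (hP : ∀ i, s' < P i) (hp : 1 / p = ∑ i, 1 / P i)
    {ω : Fin m → EuclideanSpace ℝ (Fin n) → ℝ≥0} (hω : ∀ i, AEMeasurable (ω i) volume)
    (hf : ∀ i, AEStronglyMeasurable (f i) volume)
    (hap : apConst (p / s') (fun i => P i / s') ω < ∞) :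
    weightedNorm (roughMaximal Ω f) p (jointWeight p P ω) ≤
      roughConst n s s' c P p * N * apConst (p / s') (fun i => P i / s') ω ^ (1 / p) *
        (∏ i, aInftyConst (dualWeight (P i / s') (ω i)) ^ (1 / P i)) *
        ∏ i, weightedNorm (f i) (P i) (fun x => (ω i x : ℝ≥0∞)) := by
  have hP0 : ∀ i, 0 < P i := fun i => hs'.trans (hP i)
  have hp0 : 0 < p := pos_of_one_div_eq_sum hP0 hp
  have hratio : ∀ i, p / s' / (P i / s') = p / P i := fun i => div_div_div_cancel_right₀ hs'.ne' _ _
  have hexp : ∀ i, p / P i * (1 / p) = 1 / P i := fun i => by field_simp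
  have hjoint : jointWeight (p / s') (fun i => P i / s') ω = jointWeight p P ω := by
    simp only [funext (jointWeight.eq_def _ _ _), hratio]
  have hmaximal := lintegral_multilinearMaximal_rpow_le
    (fun i => (one_lt_div hs').2 (hP i)) (div_pos hp0 hs')
    (by simpa only [hratio] using sum_div_eq_one_of_one_div_eq_sum hp0.ne' hp) hω hap
    (fun i => (hf i).enorm.pow_const s')
  simp only [hratio, hjoint, ← weightedNorm_rpow (hf _) (hω _) (hP0 _) hs'.ne'] at hmaximal
  refine (hΩ.weightedNorm_roughMaximal_le_lintegral hc hN hs' hs hf hp0 _).trans ?_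
  refine (mul_le_mul_right (ENNReal.rpow_le_rpow hmaximal (one_div_nonneg.2 hp0.le)) _).trans_eq ?_
  simp only [roughConst, ENNReal.mul_rpow_of_nonneg _ _ (one_div_nonneg.2 hp0.le),
    ← ENNReal.prod_rpow_of_nonneg (one_div_nonneg.2 hp0.le), ← ENNReal.rpow_mul, hexp,
    mul_one_div_cancel hp0.ne', ENNReal.rpow_one]
  ring

end RoughMaximal

section Sphere

variable {E : Type*} [NormedAddCommGroup E] [NormedSpace ℝ E]

open Classical in
/-- The radial projection `x ↦ x / ‖x‖` to the unit sphere, with the value `e` at `0`. -/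
noncomputable def sphereProj (e : Metric.sphere (0 : E) 1) (x : E) : Metric.sphere (0 : E) 1 :=
  ⟨if x = 0 then e else ‖x‖⁻¹ • x, by
    split_ifs with hx
    · exact e.2
    · rw [mem_sphere_zero_iff_norm, norm_smul, norm_inv, norm_norm,
        inv_mul_cancel₀ (norm_ne_zero_iff.2 hx)]⟩

theorem coe_sphereProj (e : Metric.sphere (0 : E) 1) {x : E} (hx : x ≠ 0) :
    (sphereProj e x : E) = ‖x‖⁻¹ • x :=
  if_neg hx

theorem sphereProj_smul_coe (e θ : Metric.sphere (0 : E) 1) {t : ℝ} (ht : 0 < t) :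
    sphereProj e (t • (θ : E)) = θ := by
  have hθ : ‖(θ : E)‖ = 1 := mem_sphere_zero_iff_norm.1 θ.2
  have hne : t • (θ : E) ≠ 0 := smul_ne_zero ht.ne' (ne_zero_of_mem_unit_sphere θ)
  apply Subtype.ext
  rw [coe_sphereProj e hne, norm_smul, hθ, mul_one, Real.norm_of_nonneg ht.le,
    inv_smul_smul₀ ht.ne']

theorem measurable_sphereProj [MeasurableSpace E] [BorelSpace E] [SecondCountableTopology E]
    (e : Metric.sphere (0 : E) 1) : Measurable (sphereProj e) := by
  classical
  refine Measurable.subtype_mk (Measurable.ite (measurableSet_singleton 0) measurable_const ?_)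
  fun_prop

open scoped Pointwise in
theorem sphereProj_preimage_inter_ball_sdiff_zero (e : Metric.sphere (0 : E) 1)
    (S : Set (Metric.sphere (0 : E) 1)) {R : ℝ} (hR : 0 < R) :
    (sphereProj e ⁻¹' S ∩ Metric.ball 0 R) \ {0} =
      R • (Set.Ioo (0 : ℝ) 1 • ((↑) '' S : Set E)) := by
  ext x
  simp only [Set.mem_sdiff, Set.mem_inter_iff, Set.mem_preimage, mem_ball_zero_iff,
    Set.mem_singleton_iff]
  constructor
  · rintro ⟨⟨hxS, hxR⟩, hx0⟩
    have hx := norm_pos_iff.2 hx0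
    refine Set.mem_smul_set.2 ⟨R⁻¹ • x, Set.mem_smul.2 ⟨‖x‖ / R, ⟨by positivity,
      (div_lt_one hR).2 hxR⟩, _, ⟨_, hxS, rfl⟩, ?_⟩, smul_inv_smul₀ hR.ne' x⟩
    rw [coe_sphereProj e hx0, smul_smul, div_mul_eq_mul_div, mul_inv_cancel₀ hx.ne', one_div]
  · intro hx
    obtain ⟨-, ⟨t, ⟨ht0, ht1⟩, -, ⟨θ, hθS, rfl⟩, rfl⟩, rfl⟩ := hx
    have hθ : ‖(θ : E)‖ = 1 := mem_sphere_zero_iff_norm.1 θ.2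
    have hRt : 0 < R * t := mul_pos hR ht0
    dsimp only
    rw [smul_smul]
    refine ⟨⟨by rwa [sphereProj_smul_coe e θ hRt], ?_⟩,
      smul_ne_zero hRt.ne' (ne_zero_of_mem_unit_sphere θ)⟩
    rw [norm_smul, hθ, mul_one, Real.norm_of_nonneg hRt.le]
    exact mul_lt_of_lt_one_right hR ht1

variable [MeasurableSpace E] [BorelSpace E]

theorem map_sphereProj_restrict_ball [FiniteDimensional ℝ E] [Nontrivial E] (μ : Measure E)
    [μ.IsAddHaarMeasure] (e : Metric.sphere (0 : E) 1) {R : ℝ} (hR : 0 < R) :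
    (μ.restrict (Metric.ball 0 R)).map (sphereProj e) =
      ((Module.finrank ℝ E : ℝ≥0∞)⁻¹ * ENNReal.ofReal R ^ Module.finrank ℝ E) • μ.toSphere := by
  have : ProperSpace E := FiniteDimensional.proper ℝ E
  have hd : (Module.finrank ℝ E : ℝ≥0∞) ≠ 0 := Nat.cast_ne_zero.2 Module.finrank_pos.ne'
  ext S hS
  rw [Measure.map_apply (measurable_sphereProj e) hS,
    Measure.restrict_apply (measurable_sphereProj e hS), Measure.smul_apply, smul_eq_mul,
    Measure.toSphere_apply' μ hS, ← measure_sdiff_null (measure_singleton (0 : E)),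
    sphereProj_preimage_inter_ball_sdiff_zero e S hR, Measure.addHaar_smul,
    abs_of_nonneg (by positivity), ENNReal.ofReal_pow hR.le, mul_comm _⁻¹, mul_assoc,
    ENNReal.inv_mul_cancel_left hd (by finiteness)]

variable {F : Type*} [NormedAddCommGroup F] [NormedSpace ℝ F] [MeasurableSpace F] [BorelSpace F]
  [FiniteDimensional ℝ F] [Nontrivial F]

theorem exists_map_sphereProj_comp_le (μ : Measure E) [μ.IsAddHaarMeasure] (ν : Measure F)
    [ν.IsAddHaarMeasure] (L : E ≃L[ℝ] F) (e : Metric.sphere (0 : F) 1) :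
    ∃ c : ℝ≥0∞, c ≠ ∞ ∧ ∀ R : ℝ, 0 < R →
      (μ.restrict (Metric.ball 0 R)).map (sphereProj e ∘ L) ≤
        (c * ENNReal.ofReal R ^ Module.finrank ℝ E) • ν.toSphere := by
  have : ProperSpace F := FiniteDimensional.proper ℝ F
  have hL : Measurable L := L.continuous.measurable
  have hHaar : (μ.map L).IsAddHaarMeasure := L.isAddHaarMeasure_map μ
  set k := (μ.map L).addHaarScalarFactor ν
  have hmapL : μ.map L = k • ν := Measure.isAddLeftInvariant_eq_smul _ _
  set A : ℝ := ‖(L : E →L[ℝ] F)‖ + 1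
  have hA : 0 < A := by positivity
  have hd : (Module.finrank ℝ F : ℝ≥0∞) ≠ 0 := Nat.cast_ne_zero.2 Module.finrank_pos.ne'
  refine ⟨k * ((Module.finrank ℝ F : ℝ≥0∞)⁻¹ * ENNReal.ofReal A ^ Module.finrank ℝ F),
    by finiteness, fun R hR => ?_⟩
  have hball : Metric.ball 0 R ⊆ L ⁻¹' Metric.ball 0 (A * R) := fun y hy => by
    rw [mem_ball_zero_iff] at hy
    rw [Set.mem_preimage, mem_ball_zero_iff]
    have hLy : ‖L y‖ ≤ ‖(L : E →L[ℝ] F)‖ * ‖y‖ := (L : E →L[ℝ] F).le_opNorm y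
    nlinarith [norm_nonneg (L : E →L[ℝ] F)]
  calc (μ.restrict (Metric.ball 0 R)).map (sphereProj e ∘ L)
      ≤ (μ.restrict (L ⁻¹' Metric.ball 0 (A * R))).map (sphereProj e ∘ L) :=
        Measure.map_mono (Measure.restrict_mono_set μ hball) ((measurable_sphereProj e).comp hL)
    _ = (k : ℝ≥0∞) • (ν.restrict (Metric.ball 0 (A * R))).map (sphereProj e) := by
        rw [← Measure.map_map (measurable_sphereProj e) hL,
          ← Measure.restrict_map hL Metric.isOpen_ball.measurableSet, hmapL,
          Measure.restrict_smul, Measure.map_smul]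
        rfl
    _ = _ := by
        rw [map_sphereProj_restrict_ball ν e (mul_pos hA hR), smul_smul,
          L.toLinearEquiv.finrank_eq, ENNReal.ofReal_mul hA.le, mul_pow]
        congr 1
        ring

end Sphere

section HomogeneousKernel

variable {n m : ℕ}

theorem exists_hasBallBound_of_restrictSphere [NeZero n] [NeZero m] :
    ∃ c : ℝ≥0∞, c ≠ ∞ ∧ ∀ Ω : (Fin m → EuclideanSpace ℝ (Fin n)) → ℂ,
      (∀ t : ℝ, 0 < t → ∀ y, Ω (fun i => t • y i) = Ω y) → ∀ s : ℝ≥0∞,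
      AEStronglyMeasurable (restrictSphere Ω) (sphereMeasure n m) →
      HasBallBound volume Ω s c (eLpNorm (restrictSphere Ω) s (sphereMeasure n m)) := by
  set L := (PiLp.continuousLinearEquiv 2 ℝ (fun _ : Fin m => EuclideanSpace ℝ (Fin n))).symm
  have : Nontrivial (PiLp 2 fun _ : Fin m => EuclideanSpace ℝ (Fin n)) :=
    L.symm.toEquiv.nontrivial
  obtain ⟨e⟩ := (NormedSpace.sphere_nonempty
    (E := PiLp 2 fun _ : Fin m => EuclideanSpace ℝ (Fin n)).2 zero_le_one).to_subtype
  obtain ⟨c, hc, hmap⟩ := exists_map_sphereProj_comp_le volume volume L e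
  refine ⟨c, hc, fun Ω hhom s hΩ => HasBallBound.of_map_le
    ((measurable_sphereProj e).comp L.continuous.measurable) hmap hΩ ?_ s⟩
  have : NullSingletonClass (volume : Measure (Fin m → EuclideanSpace ℝ (Fin n))) :=
    Measure.pi_nullSingletonClass 0
  filter_upwards [Measure.ae_ne volume 0] with y hy
  have hLy : L y ≠ 0 := by simpa using hy
  rw [← hhom ‖L y‖⁻¹ (inv_pos.2 (norm_pos_iff.2 hLy)) y]
  simp only [Function.comp_apply, restrictSphere, coe_sphereProj e hLy]
  rfl

theorem hasBallBound_of_restrictSpheres [NeZero n]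
    {Ω : (Fin m → EuclideanSpace ℝ (Fin n)) → ℂ}
    (hhom : ∀ t : Fin m → ℝ, (∀ i, 0 < t i) → ∀ y, Ω (fun i => t i • y i) = Ω y) (s : ℝ≥0∞)
    (hΩ : AEStronglyMeasurable (restrictSpheres Ω) (spheresMeasure n m)) :
    HasBallBound volume Ω s ((n : ℝ≥0∞)⁻¹ ^ m)
      (eLpNorm (restrictSpheres Ω) s (spheresMeasure n m)) := by
  obtain ⟨e⟩ := (NormedSpace.sphere_nonempty
    (E := EuclideanSpace ℝ (Fin n)).2 zero_le_one).to_subtype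
  have hproj : Measurable fun (y : Fin m → EuclideanSpace ℝ (Fin n)) i => sphereProj e (y i) :=
    measurable_pi_iff.2 fun i => (measurable_sphereProj e).comp (measurable_pi_apply i)
  refine HasBallBound.of_map_le hproj (fun R hR => ?_) hΩ ?_ s
  · have hfin : IsFiniteMeasure ((volume : Measure (EuclideanSpace ℝ (Fin n))).restrict
        (Metric.ball 0 R)) := ⟨by simpa using measure_ball_lt_top⟩
    rw [ball_pi _ hR, volume_pi, Measure.restrict_pi_pi,
      Measure.pi_map_pi fun _ => (measurable_sphereProj e).aemeasurable]
    refine le_of_eq (Measure.pi_eq fun S _ => ?_)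
    simp only [Pi.zero_apply, map_sphereProj_restrict_ball _ e hR, Measure.smul_apply, smul_eq_mul,
      spheresMeasure, Measure.pi_pi, Finset.prod_mul_distrib, Finset.prod_const,
      Finset.card_univ, Fintype.card_fin, finrank_euclideanSpace, Module.finrank_pi_fintype,
      Finset.sum_const, ← pow_mul, mul_comm n m]
  · have hne : ∀ᵐ y : Fin m → EuclideanSpace ℝ (Fin n), ∀ i, y i ≠ 0 :=
      ae_all_iff.2 fun i => Measure.ae_eval_ne _ i 0
    filter_upwards [hne] with y hy
    rw [← hhom (fun i => ‖y i‖⁻¹) (fun i => inv_pos.2 (norm_pos_iff.2 (hy i))) y]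
    simp only [Function.comp_apply, restrictSpheres, coe_sphereProj e (hy _)]

end HomogeneousKernel

theorem theorem1p8 (n m : ℕ) (hn : 0 < n) (hm : 0 < m)
    (s : ℝ≥0∞) (s' : ℝ) (hs' : 1 ≤ s') (hs : s.HolderConjugate (ENNReal.ofReal s'))
    (P : Fin m → ℝ) (hP : ∀ i, s' < P i) (p : ℝ) (hp : 1 / p = ∑ i, 1 / P i) :
    ∃ C : ℝ≥0,
      ∀ (ω : Fin m → EuclideanSpace ℝ (Fin n) → ℝ≥0)
        (f : Fin m → EuclideanSpace ℝ (Fin n) → ℂ)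
        (Ω : (Fin m → EuclideanSpace ℝ (Fin n)) → ℂ),
        (∀ i, AEMeasurable (ω i) volume) →
        (∀ i, AEStronglyMeasurable (f i) volume) →
        apConst (p / s') (fun i => P i / s') ω < ∞ →
        ((∀ t : ℝ, 0 < t → ∀ y, Ω (fun i => t • y i) = Ω y) →
          MemLp (restrictSphere Ω) s (sphereMeasure n m) →
          weightedNorm (roughMaximal Ω f) p (jointWeight p P ω) ≤
            C * eLpNorm (restrictSphere Ω) s (sphereMeasure n m) *
              apConst (p / s') (fun i => P i / s') ω ^ (1 / p) *
              (∏ i, aInftyConst (dualWeight (P i / s') (ω i)) ^ (1 / P i)) *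
              ∏ i, weightedNorm (f i) (P i) (fun x => (ω i x : ℝ≥0∞))) ∧
        ((∀ t : Fin m → ℝ, (∀ i, 0 < t i) → ∀ y, Ω (fun i => t i • y i) = Ω y) →
          MemLp (restrictSpheres Ω) s (spheresMeasure n m) →
          weightedNorm (roughMaximal Ω f) p (jointWeight p P ω) ≤
            C * eLpNorm (restrictSpheres Ω) s (spheresMeasure n m) *
              apConst (p / s') (fun i => P i / s') ω ^ (1 / p) *
              (∏ i, aInftyConst (dualWeight (P i / s') (ω i)) ^ (1 / P i)) *
              ∏ i, weightedNorm (f i) (P i) (fun x => (ω i x : ℝ≥0∞))) := by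
  have : NeZero n := ⟨hn.ne'⟩
  have : NeZero m := ⟨hm.ne'⟩
  have hs'0 : 0 < s' := by linarith
  have hp0 : 0 < p := pos_of_one_div_eq_sum (fun i => hs'0.trans (hP i)) hp
  obtain ⟨c, hc, hsphere⟩ := exists_hasBallBound_of_restrictSphere (n := n) (m := m)
  have hc' : (n : ℝ≥0∞)⁻¹ ^ m ≠ ∞ := by finiteness
  refine ⟨max (roughConst n s s' c P p).toNNReal
    (roughConst n s s' ((n : ℝ≥0∞)⁻¹ ^ m) P p).toNNReal, fun ω f Ω hω hf hap => ?_⟩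
  rw [ENNReal.coe_max, ENNReal.coe_toNNReal (roughConst_ne_top hc hs'0 hP hp0),
    ENNReal.coe_toNNReal (roughConst_ne_top hc' hs'0 hP hp0)]
  refine ⟨fun hhom hΩ => ?_, fun hhom hΩ => ?_⟩
  · refine ((hsphere Ω hhom s hΩ.1).weightedNorm_roughMaximal_le hc hΩ.2.ne hs'0 hs hP hp hω hf
      hap).trans ?_
    gcongr
    exact le_max_left _ _
  · refine ((hasBallBound_of_restrictSpheres hhom s hΩ.1).weightedNorm_roughMaximal_le hc' hΩ.2.ne
      hs'0 hs hP hp hω hf hap).trans ?_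
    gcongr
    exact le_max_right _ _
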